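/- Let $n\ge 0$, and let $\mathcal C$ be a finitely generated based free chain complex $0\to C_m\xrightarrow{\partial_m}C_{m-1}\to\dots\xrightarrow{\partial_1}C_0\to 0$ over $\mathbb Z[\mathbb Z^n]$ (each $C_k$ is a free module of finite rank with a preferred basis). Suppose that $\mathcal C$ is $L^2$-acyclic, i.e. for every $k$ the reduced $\ell^2$-homology $\ker(\partial_k)/\overline{\operatorname{im}(\partial_{k+1})}$ of the complex of Hilbert spaces $\ell^2(\mathbb Z^n)\otimes_{\mathbb Z[\mathbb Z^n]}C_k$ is zero. For a subgroup $\Gamma\le\mathbb Z^n$ of finite index let $\mathcal C_\Gamma=\mathbb Z[\mathbb Z^n/\Gamma]\otimes_{\mathbb Z[\mathbb Z^n]}\mathcal C$, a finitely generated based free $\mathbb Z$-complex with the induced bases, and put $$\tau^H(\mathcal C_\Gamma)=\Big(\prod_k|\operatorname{Tor}_{\mathbb Z}H_k(\mathcal C_\Gamma)|^{(-1)^k}\Big)^{-1},\qquad \tau^{RS}(\mathcal C_\Gamma)=\prod_k{\det}'(\partial_{k,\Gamma})^{(-1)^k},$$ where $\operatorname{Tor}_{\mathbb Z}$ denotes the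 torsion subgroup, $\partial_{k,\Gamma}$ is the $k$-th boundary map of $\mathcal C_\Gamma\otimes\mathbb C$, and $\det'$ is the product, with multiplicity, of the nonzero singular values with respect to the Hermitian products for which the preferred bases are orthonormal ($\det'(0)=1$). Fix a finite generating set $S$ of $\mathbb Z^n$ with word length $l_S$ and let $\langle\Gamma\rangle=\min\{l_S(x): x\in\Gamma\setminus\{0\}\}$ (with $\langle\Gamma\rangle=\infty$ if $\Gamma$ is trivial). Then $$\lim_{\langle\Gamma\rangle\to\infty,\ [\mathbb Z^n:\Gamma]<\infty}\frac{\ln\tau^H(\mathcal C_\Gamma)-\ln\tau^{RS}(\mathcal C_\Gamma)}{[\mathbb Z^n:\Gamma]}=0,$$ i.e. for every $\varepsilon>0$ there is $N$ such that the quotient has absolute value less than $\varepsilon$ for every finite-index subgroup $\Gamma\le\mathbb Z^n$ with $\langle\Gamma\rangle\ge N$. -/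

import Mathlib

/-!
Based free complexes over commutative rings (in particular over group rings of abelian groups),
their finite quotients, the homology torsion and the combinatorial Ray-Singer torsion,
reduced `ℓ²`-homology, and word length.  Abelian groups are written additively.
-/

noncomputable section

namespace TorsionGrowth

/-- A finitely generated based free chain complex
`0 → C_m → ⋯ → C_1 → C_0 → 0` over a commutative ring `R`. The module `C_k` is free on the finite
set `ι k`, that is `C_k = (ι k → R)` with its standard basis, and `d k` is the matrix of the boundary
map `∂_{k+1} : C_{k+1} → C_k` acting on column vectors. -/
structure BasedComplex (R : Type*) [CommRing R] where
  /-- the top degree `m` -/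
  length : ℕ
  /-- the preferred basis of `C_k` -/
  ι : ℕ → Type
  [fintypeBasis : ∀ k, Fintype (ι k)]
  [decEqBasis : ∀ k, DecidableEq (ι k)]
  isEmpty_of_lt : ∀ k, length < k → IsEmpty (ι k)
  /-- `d k` is the matrix of `∂_{k+1} : C_{k+1} → C_k` -/
  d : ∀ k, Matrix (ι k) (ι (k + 1)) R
  d_mul_d : ∀ k, d k * d (k + 1) = 0

attribute [instance] BasedComplex.fintypeBasis BasedComplex.decEqBasis

namespace BasedComplex

/-! ### Homology -/

section Homology

variable {R : Type*} [CommRing R] (E : BasedComplex R)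

/-- The cycles `Z_k = ker ∂_k` (with `∂_0 = 0`). -/
def cycles : (k : ℕ) → Submodule R (E.ι k → R)
  | 0 => ⊤
  | k + 1 => LinearMap.ker (E.d k).mulVecLin

/-- The boundaries `B_k = im ∂_{k+1}`. -/
def boundaries (k : ℕ) : Submodule R (E.ι k → R) :=
  LinearMap.range (E.d k).mulVecLin

/-- The homology `H_k = Z_k / B_k`. -/
abbrev Homology (k : ℕ) : Type _ :=
  ↥(E.cycles k) ⧸ (E.boundaries k).submoduleOf (E.cycles k)

/-- Base change of a based free complex along a ring homomorphism `R → S`: this is `S ⊗_R C`, with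
the basis induced by that of `C`. -/
def baseChange {S : Type*} [CommRing S] (f : R →+* S) : BasedComplex S where
  length := E.length
  ι := E.ι
  isEmpty_of_lt := E.isEmpty_of_lt
  d k := (E.d k).map f
  d_mul_d k := by
    rw [← Matrix.map_mul, E.d_mul_d]
    ext i j
    simp

end Homology

/-! ### Finite quotients -/

section Quotient

/-- The matrix over `ℤ` of a matrix over `ℤ[A]`, `A` a finite abelian group, where `ℤ[A]` is given the
`ℤ`-basis `A`: since `M i j * b = ∑ a, (M i j) (a - b) • a`, the entry at `((i, a), (j, b))` is the
coefficient of `a - b` in `M i j`. -/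
def regularMatrix {A : Type*} [AddCommGroup A] {ι κ : Type*}
    (M : Matrix ι κ (AddMonoidAlgebra ℤ A)) : Matrix (ι × A) (κ × A) ℤ :=
  Matrix.of fun x y => (M x.1 y.1).coeff (x.2 - y.2)

theorem regularMatrix_mul {A : Type*} [AddCommGroup A] [Fintype A] {ι κ μ : Type*} [Fintype κ]
    (M : Matrix ι κ (AddMonoidAlgebra ℤ A)) (N : Matrix κ μ (AddMonoidAlgebra ℤ A)) :
    regularMatrix M * regularMatrix N = regularMatrix (M * N) := by
  classical
  ext ⟨i, a⟩ ⟨k, c⟩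
  have key : ∀ (f g : AddMonoidAlgebra ℤ A),
      ∑ b : A, f.coeff (a - b) * g.coeff (b - c) = (f * g).coeff (a - c) := by
    intro f g
    rw [AddMonoidAlgebra.coeff_mul_apply_right, Finsupp.sum_fintype _ _ (by simp)]
    refine Fintype.sum_equiv (Equiv.subRight c) _ _ fun b => ?_
    simp [sub_eq_add_neg, add_assoc]
  simp only [regularMatrix, Matrix.mul_apply, Matrix.of_apply, Fintype.sum_prod_type]
  simp only [key]
  simp [AddMonoidAlgebra.coeff_sum, Finsupp.finsetSum_apply]

/-- A based free complex over `ℤ[A]`, with `A` a finite abelian group, viewed as a based free complex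
over `ℤ`: the module `ℤ[A]^ι` has the `ℤ`-basis `ι × A`, consisting of the elements `a • e_i`. -/
def restrictScalars {A : Type} [AddCommGroup A] [Fintype A] [DecidableEq A]
    (E : BasedComplex (AddMonoidAlgebra ℤ A)) : BasedComplex ℤ where
  length := E.length
  ι k := E.ι k × A
  isEmpty_of_lt k hk := by
    have := E.isEmpty_of_lt k hk
    infer_instance
  d k := regularMatrix (E.d k)
  d_mul_d k := by
    rw [regularMatrix_mul, E.d_mul_d]
    ext x y
    simp [regularMatrix]

open Classical in
/-- The quotient `C_Γ = ℤ[G/Γ] ⊗_{ℤ[G]} C` for a subgroup `Γ` of finite index of an abelian group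
`G`, as a based free complex over `ℤ`. -/
def quotient {G : Type} [AddCommGroup G] (C : BasedComplex (AddMonoidAlgebra ℤ G))
    (Γ : AddSubgroup G) [Γ.FiniteIndex] : BasedComplex ℤ :=
  letI : Fintype (G ⧸ Γ) := Fintype.ofFinite (G ⧸ Γ)
  (C.baseChange (AddMonoidAlgebra.mapDomainRingHom ℤ (QuotientAddGroup.mk' Γ))).restrictScalars

end Quotient

/-! ### The two torsions of a based free complex over `ℤ` -/

section Torsions

/-- The geometric determinant of a linear map between finite-dimensional Hermitian spaces: the
product of its nonzero singular values, counted with multiplicity. -/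
def geomDet {V W : Type*} [NormedAddCommGroup V] [InnerProductSpace ℂ V] [FiniteDimensional ℂ V]
    [NormedAddCommGroup W] [InnerProductSpace ℂ W] [FiniteDimensional ℂ W] (f : V →ₗ[ℂ] W) : ℝ :=
  f.singularValues.prod fun _ s => s

variable (E : BasedComplex ℤ)

/-- The boundary map `∂_{k+1} ⊗ ℂ` between the Hermitian spaces `E_{k+1} ⊗ ℂ` and `E_k ⊗ ℂ`, in
which the preferred bases are orthonormal. -/
def complexBoundary (k : ℕ) : EuclideanSpace ℂ (E.ι (k + 1)) →ₗ[ℂ] EuclideanSpace ℂ (E.ι k) :=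
  Matrix.toEuclideanLin ((E.d k).map (Int.castRingHom ℂ))

/-- The combinatorial Ray-Singer torsion `∏_k det'(∂_k) ^ ((-1) ^ k)`; the product is over
`k = 1, …, m`, as `∂_k = 0` (and hence `det'(∂_k) = 1`) for all other `k`. -/
def raySingerTorsion : ℝ :=
  ∏ k ∈ Finset.range E.length, geomDet (E.complexBoundary k) ^ ((-1 : ℤ) ^ (k + 1))

/-- The homology torsion `(∏_k |Tor_ℤ H_k| ^ ((-1) ^ k))⁻¹`. -/
def homologyTorsion : ℝ :=
  (∏ k ∈ Finset.range (E.length + 1),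
    (Nat.card (Submodule.torsion ℤ (E.Homology k)) : ℝ) ^ ((-1 : ℤ) ^ k))⁻¹

end Torsions

/-! ### Reduced `ℓ²`-homology -/

section L2

variable {G : Type*} [AddCommGroup G]

/-- The Hilbert space `ℓ²(G)`. -/
abbrev L2 (G : Type*) : Type _ := lp (fun _ : G => ℂ) 2

theorem memℓp_l2Translate (h : G) (x : L2 G) : Memℓp (fun g => x (g - h)) 2 := by
  have hp : 0 < (2 : ENNReal).toReal := by norm_num
  rw [memℓp_gen_iff hp]
  exact ((lp.memℓp x).summable hp).comp_injective (Equiv.subRight h).injective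

/-- Translation by `h` on `ℓ²(G)`, `(h • x) g = x (g - h)`. -/
def l2Translate (h : G) : L2 G →ₗᵢ[ℂ] L2 G where
  toFun x := ⟨fun g => x (g - h), memℓp_l2Translate h x⟩
  map_add' _ _ := rfl
  map_smul' _ _ := rfl
  norm_map' x := by
    have hp : 0 < (2 : ENNReal).toReal := by norm_num
    rw [lp.norm_eq_tsum_rpow hp, lp.norm_eq_tsum_rpow hp]
    congr 1
    exact (Equiv.subRight h).tsum_eq fun g => ‖x g‖ ^ (2 : ENNReal).toReal

/-- The action of `f ∈ ℤ[G]` on `ℓ²(G)` by convolution, `(f • x) g = ∑ h, f h * x (g - h)`. -/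
def convolution (f : AddMonoidAlgebra ℤ G) : L2 G →L[ℂ] L2 G :=
  f.coeff.sum fun h a => (a : ℂ) • (l2Translate h).toContinuousLinearMap

variable (C : BasedComplex (AddMonoidAlgebra ℤ G))

/-- The `ℓ²`-chains `ℓ²(G) ⊗_{ℤ[G]} C_k = ℓ²(G)^{ι k}`, with the topology of the finite (Hilbert)
direct sum. -/
abbrev L2Chains (k : ℕ) : Type _ := C.ι k → L2 G

/-- The boundary map `∂_{k+1}` on `ℓ²`-chains. -/
def l2Boundary (k : ℕ) : C.L2Chains (k + 1) →L[ℂ] C.L2Chains k :=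
  ContinuousLinearMap.pi fun i =>
    ∑ j, (convolution (C.d k i j)).comp (ContinuousLinearMap.proj j)

/-- The `ℓ²`-cycles `ker ∂_k` (with `∂_0 = 0`). -/
def l2Cycles : (k : ℕ) → Submodule ℂ (C.L2Chains k)
  | 0 => ⊤
  | k + 1 => LinearMap.ker (C.l2Boundary k).toLinearMap

/-- The closure of the `ℓ²`-boundaries `im ∂_{k+1}`. -/
def l2Boundaries (k : ℕ) : Submodule ℂ (C.L2Chains k) :=
  (LinearMap.range (C.l2Boundary k).toLinearMap).topologicalClosure

/-- The (reduced) `L²`-homology `ker ∂_k / closure (im ∂_{k+1})`. -/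
abbrev L2Homology (k : ℕ) : Type _ :=
  ↥(C.l2Cycles k) ⧸ (C.l2Boundaries k).submoduleOf (C.l2Cycles k)

/-- The complex is `L²`-acyclic if all its reduced `L²`-homology vanishes. -/
def IsL2Acyclic : Prop := ∀ k, Subsingleton (C.L2Homology k)

end L2

end BasedComplex

/-! ### Word length -/

section WordLength

variable {G : Type*} [AddCommGroup G]

/-- The word length of `x` with respect to `S`: the least length of a word in the elements of `S` and
their inverses that represents `x`. -/
def wordLength (S : Set G) (x : G) : ℕ :=
  sInf {k | ∃ l : List G, l.length = k ∧ (∀ y ∈ l, y ∈ S ∨ -y ∈ S) ∧ l.sum = x}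

/-- `⟨Γ⟩`, the minimal word length of a nontrivial element of `Γ` (`⊤` if `Γ` is trivial). -/
def minLength (S : Set G) (Γ : AddSubgroup G) : ℕ∞ :=
  ⨅ x ∈ {x : G | x ∈ Γ ∧ x ≠ 0}, (wordLength S x : ℕ∞)

end WordLength

end TorsionGrowth

end

/-! Over `ℤ`, both torsions are expressed by covolumes of lattices. The square of `det'(∂_{k+1})` is
the product of the squared covolumes of the cycles `Z_{k+1}` and the boundaries `B_k`
(`geomDet_sq_eq_gdet_mul_gdet`), and the squared covolume of `B_k` is `|Tor H_k|²` times that of the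
saturation of `B_k` in `Z_k` (`gdet_eq_card_torsion_sq_mul`). In the alternating sum, what remains
in degree `k` is the comparison of `Z_k` with the saturated boundaries, and these differ at most by
the covolume of the lattice of integral harmonic chains. Hence the logarithms of the two torsions
differ by at most half the sum of the logarithms of the squared harmonic covolumes
(`abs_log_homologyTorsion_sub_log_raySingerTorsion_le`).

It remains to see that these logarithms are `o([ℤ^n : Γ])`. By `L²`-acyclicity the Laplacian over
`ℤ[ℤ^n]` has determinant `f ≠ 0` (`det_laplacian_ne_zero`). A character of `A = ℤ^n/Γ` at which `f`
vanishes yields a vanishing sum of `k` roots of unity, where `k` is the size of the support of `f`;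
by a Galois and Vandermonde argument (`exists_pow_factorial_eq`) it is trivial on `k!(m - m')` for
two distinct support points. So there are finitely many nonzero directions, independent of `Γ`, such
that every zero of `f` on the dual of `A` factors through the quotient of `A` by one of them.

Integrally, `f` and the orbit sums of these directions generate an ideal of `ℤ[A]` containing an
integer `c ≠ 0` (`exists_intCast_eq_mul_add_sum`), so `c` times a harmonic chain is a sum of chains
pulled back from kernels over the quotients `A/⟨m⟩`. No control of `c` is needed, since passing to a
sublattice of finite index only enlarges the covolume. The pulled-back lattices have rank
`O(|A|/o(m))`, with `o(m)` the order of `m` in `A`, and the Laplacians are uniformly bounded, so the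
logarithm of the squared harmonic covolume is at most a sum of terms of order `|A| log(K o(m)) /
o(m)` (`log_gdet_ker_regularMatrix_le`). Since `o(m) • m` is a nonzero element of `Γ`, `o(m)` tends
to infinity with `⟨Γ⟩`. -/

set_option linter.unusedSectionVars false

noncomputable section

namespace TorsionGrowth

open Matrix Module

/-! ### Gram determinants of integral lattices -/

section Lattice

variable {X κ μ : Type*} [Fintype X] [Fintype κ] [DecidableEq κ] [Fintype μ] [DecidableEq μ]

/-- The columns of `B` form a basis of the lattice `L ⊆ ℤ^X`. -/
structure IsBasisMatrix (B : Matrix X κ ℤ) (L : Submodule ℤ (X → ℤ)) : Prop where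
  eq_zero : ∀ v, B *ᵥ v = 0 → v = 0
  range_eq : LinearMap.range B.mulVecLin = L

theorem gram_mulVec_eq_zero {B : Matrix X κ ℤ} {v : κ → ℤ} (h : (Bᵀ * B) *ᵥ v = 0) :
    B *ᵥ v = 0 := by
  have h1 : (B *ᵥ v) ⬝ᵥ (B *ᵥ v) = 0 := by
    rw [Matrix.dotProduct_mulVec, Matrix.vecMul_mulVec, ← Matrix.dotProduct_mulVec,
      h, dotProduct_zero]
  exact dotProduct_self_eq_zero.mp h1

theorem det_gram_nonneg (B : Matrix X κ ℤ) : 0 ≤ (Bᵀ * B).det := by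
  have h := (Matrix.posSemidef_conjTranspose_mul_self (B.map (Int.cast : ℤ → ℝ))).det_nonneg
  have e : (B.map (Int.cast : ℤ → ℝ))ᴴ * B.map (Int.cast : ℤ → ℝ)
      = (Int.castRingHom ℝ).mapMatrix (Bᵀ * B) := by
    ext i j
    simp [Matrix.mul_apply]
  rw [e, ← RingHom.map_det, eq_intCast] at h
  exact_mod_cast h

theorem det_gram_pos {B : Matrix X κ ℤ} (hB : ∀ v, B *ᵥ v = 0 → v = 0) :
    0 < (Bᵀ * B).det := by
  refine lt_of_le_of_ne (det_gram_nonneg B) fun h => ?_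
  obtain ⟨v, hv, hv'⟩ := Matrix.exists_mulVec_eq_zero_iff.mpr h.symm
  exact hv (hB v (gram_mulVec_eq_zero hv'))

namespace IsBasisMatrix

variable {B : Matrix X κ ℤ} {L : Submodule ℤ (X → ℤ)}

theorem ker_eq (hB : IsBasisMatrix B L) : LinearMap.ker B.mulVecLin = ⊥ :=
  LinearMap.ker_eq_bot'.mpr fun v hv => hB.eq_zero v hv

theorem mulVec_mem (hB : IsBasisMatrix B L) (v : κ → ℤ) : B *ᵥ v ∈ L :=
  hB.range_eq ▸ ⟨v, rfl⟩

theorem exists_mulVec_eq (hB : IsBasisMatrix B L) {x : X → ℤ} (hx : x ∈ L) :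
    ∃ v, B *ᵥ v = x := by
  rw [← hB.range_eq] at hx
  exact hx

theorem exists_mul_eq (hB : IsBasisMatrix B L) {B' : Matrix X μ ℤ}
    (hB' : ∀ v, B' *ᵥ v ∈ L) : ∃ P : Matrix κ μ ℤ, B' = B * P := by
  choose P hP using fun j => hB.exists_mulVec_eq (hB' (Pi.single j 1))
  refine ⟨Matrix.of fun i j => P j i, ?_⟩
  ext x j
  have := congrFun (hP j) x
  simp only [mulVec_single_one] at this
  simpa [Matrix.mul_apply, mulVec, dotProduct] using this.symm

theorem mul_left_cancel (hB : IsBasisMatrix B L) {P Q : Matrix κ μ ℤ} (h : B * P = B * Q) :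
    P = Q := by
  have h1 : ∀ v, P *ᵥ v = Q *ᵥ v := fun v => by
    refine sub_eq_zero.mp (hB.eq_zero _ ?_)
    rw [mulVec_sub, mulVec_mulVec, mulVec_mulVec, h, sub_self]
  exact Matrix.ext_of_mulVec_single fun i => h1 _

/-- The basis of `L` given by the columns. -/
def basis (hB : IsBasisMatrix B L) : Basis κ ℤ L :=
  (Pi.basisFun ℤ κ).map
    ((LinearEquiv.ofInjective B.mulVecLin (LinearMap.ker_eq_bot.mp hB.ker_eq)).trans
      (LinearEquiv.ofEq _ _ hB.range_eq))

theorem basis_apply (hB : IsBasisMatrix B L) (j : κ) (x : X) : (hB.basis j : X → ℤ) x = B x j := by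
  have : (hB.basis j : X → ℤ) = B *ᵥ (Pi.single j 1) := by
    simp [basis, LinearEquiv.ofInjective_apply]
  rw [this]
  simp

theorem reindex (hB : IsBasisMatrix B L) (e : μ ≃ κ) : IsBasisMatrix (B.submatrix id e) L := by
  have key : ∀ v, (B.submatrix id e) *ᵥ v = B *ᵥ (v ∘ e.symm) := fun v => by
    simpa using submatrix_mulVec_equiv B v id e
  constructor
  · intro v hv
    have := hB.eq_zero _ ((key v).symm.trans hv)
    ext i
    simpa using congrFun this (e i)
  · rw [← hB.range_eq]
    ext x
    constructor
    · rintro ⟨v, rfl⟩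
      exact ⟨_, (key v).symm⟩
    · rintro ⟨v, rfl⟩
      refine ⟨v ∘ e, ?_⟩
      rw [mulVecLin_apply, key, mulVecLin_apply, Function.comp_assoc, e.self_comp_symm,
        Function.comp_id]

theorem of_basis (b : Basis κ ℤ L) : IsBasisMatrix (Matrix.of fun x j => (b j : X → ℤ) x) L := by
  have key : ∀ v, (Matrix.of fun x j => (b j : X → ℤ) x) *ᵥ v = (b.equivFun.symm v : X → ℤ) := by
    intro v
    ext x
    simp [mulVec, dotProduct, Basis.equivFun_symm_apply, mul_comm]
  constructor
  · intro v hv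
    rw [key] at hv
    exact b.equivFun.symm.map_eq_zero_iff.mp (Subtype.ext hv)
  · ext x
    constructor
    · rintro ⟨v, rfl⟩
      rw [mulVecLin_apply, key]
      exact SetLike.coe_mem _
    · intro hx
      exact ⟨b.equivFun ⟨x, hx⟩, by rw [mulVecLin_apply, key]; simp⟩

end IsBasisMatrix

theorem exists_isBasisMatrix (L : Submodule ℤ (X → ℤ)) :
    ∃ (r : ℕ) (B : Matrix X (Fin r) ℤ), IsBasisMatrix B L :=
  ⟨_, _, IsBasisMatrix.of_basis (Module.finBasis ℤ L)⟩

/-- The squared covolume of a lattice: the Gram determinant of any of its bases. -/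
def gdet (L : Submodule ℤ (X → ℤ)) : ℤ :=
  ((exists_isBasisMatrix L).choose_spec.chooseᵀ * (exists_isBasisMatrix L).choose_spec.choose).det

theorem det_gram_mul (B : Matrix X κ ℤ) (P : Matrix κ κ ℤ) :
    ((B * P)ᵀ * (B * P)).det = P.det ^ 2 * (Bᵀ * B).det := by
  rw [transpose_mul, Matrix.mul_assoc, ← Matrix.mul_assoc Bᵀ, det_mul, det_mul, det_transpose]
  ring

namespace IsBasisMatrix

variable {B : Matrix X κ ℤ} {L : Submodule ℤ (X → ℤ)}

/-- Two bases differ by an invertible integral matrix, whose determinant is `±1` and enters the Gram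
determinant squared. This makes `gdet` independent of the chosen basis. -/
theorem det_gram_eq {B' : Matrix X μ ℤ} (hB : IsBasisMatrix B L) (hB' : IsBasisMatrix B' L) :
    (Bᵀ * B).det = (B'ᵀ * B').det := by
  let e : κ ≃ μ := hB.basis.indexEquiv hB'.basis
  have h1 := hB'.reindex e
  have h2 : ((B'.submatrix id e)ᵀ * (B'.submatrix id e)).det = (B'ᵀ * B').det := by
    rw [← det_submatrix_equiv_self e]
    rfl
  rw [← h2]
  obtain ⟨P, hP⟩ := hB.exists_mul_eq (fun v => h1.mulVec_mem v)
  obtain ⟨Q, hQ⟩ := h1.exists_mul_eq (fun v => hB.mulVec_mem v)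
  have h3 : P * Q = 1 := hB.mul_left_cancel (by rw [← Matrix.mul_assoc, ← hP, ← hQ, Matrix.mul_one])
  have h4 : P.det * Q.det = 1 := by rw [← det_mul, h3, det_one]
  have h5 : P.det ^ 2 = 1 := by
    rcases Int.isUnit_iff.mp (IsUnit.of_mul_eq_one _ h4) with h | h <;> rw [h] <;> norm_num
  rw [hP, det_gram_mul, h5, one_mul]

theorem gdet_eq (hB : IsBasisMatrix B L) : gdet L = (Bᵀ * B).det :=
  det_gram_eq (exists_isBasisMatrix L).choose_spec.choose_spec hB

/-- The matrix expressing a basis of `L'` in a basis of `L` has determinant of absolute value `[L :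
L']`. The common index type `κ` encodes equality of ranks. -/
theorem gdet_eq_card_sq_mul {B' : Matrix X κ ℤ} {L' : Submodule ℤ (X → ℤ)}
    (hB : IsBasisMatrix B L) (hB' : IsBasisMatrix B' L') (h : L' ≤ L) :
    gdet L' = (Nat.card (L ⧸ L'.submoduleOf L) : ℤ) ^ 2 * gdet L := by
  obtain ⟨P, hP⟩ := hB.exists_mul_eq (fun v => h (hB'.mulVec_mem v))
  let b' := hB'.basis.map (Submodule.submoduleOfEquivOfLe h).symm
  have key := Submodule.natAbs_det_basis_change hB.basis (L'.submoduleOf L) b'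
  have hb' : ∀ j x, ((b' j : L) : X → ℤ) x = B' x j := fun j x => by
    rw [← hB'.basis_apply j x]
    rfl
  have hPm : hB.basis.toMatrix ((↑) ∘ b') = P := by
    refine hB.mul_left_cancel ?_
    rw [← hP]
    ext x j
    have h1 := hB.basis.sum_toMatrix_smul_self ((↑) ∘ b') j
    have h2 := congrFun (congrArg Subtype.val h1) x
    rw [Function.comp_apply, hb'] at h2
    rw [← h2, Submodule.coe_sum, Finset.sum_apply, Matrix.mul_apply]
    exact Finset.sum_congr rfl fun i _ => by
      rw [Submodule.coe_smul, Pi.smul_apply, smul_eq_mul, hB.basis_apply, mul_comm]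
  have hk : (Nat.card (L ⧸ L'.submoduleOf L) : ℤ) ^ 2 = P.det ^ 2 := by
    rw [← key, ← hPm, Basis.det_apply, Int.natCast_natAbs, sq_abs]
  rw [hB'.gdet_eq, hB.gdet_eq, hk, hP, det_gram_mul]

end IsBasisMatrix

theorem gdet_pos (L : Submodule ℤ (X → ℤ)) : 0 < gdet L := by
  obtain ⟨r, B, hB⟩ := exists_isBasisMatrix L
  rw [hB.gdet_eq]
  exact det_gram_pos hB.eq_zero

theorem gdet_bot : gdet (⊥ : Submodule ℤ (X → ℤ)) = 1 := by
  have : IsBasisMatrix (0 : Matrix X Empty ℤ) ⊥ :=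
    ⟨fun v _ => Subsingleton.elim _ _, by simp⟩
  rw [this.gdet_eq]
  simp

theorem gdet_top [DecidableEq X] : gdet (⊤ : Submodule ℤ (X → ℤ)) = 1 := by
  have : IsBasisMatrix (1 : Matrix X X ℤ) ⊤ :=
    ⟨fun v h => by simpa using h, by simp⟩
  rw [this.gdet_eq]
  simp

/-- A primitive sublattice has a basis which extends to a basis of the lattice. -/
theorem exists_isBasisMatrix_fromCols {L' L : Submodule ℤ (X → ℤ)} (h : L' ≤ L)
    (hp : ∀ x ∈ L, ∀ n : ℤ, n ≠ 0 → n • x ∈ L' → x ∈ L') :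
    ∃ (r s : ℕ) (K : Matrix X (Fin r) ℤ) (W : Matrix X (Fin s) ℤ),
      IsBasisMatrix K L' ∧ IsBasisMatrix (fromCols K W) L := by
  -- Primitivity makes the quotient torsion-free, hence free, so a basis of it lifts and completes
  -- one of `L'`.
  have : IsTorsionFree ℤ (L ⧸ L'.submoduleOf L) := by
    refine Module.IsTorsionFree.of_smul_eq_zero ?_
    intro n x hx
    obtain ⟨x, rfl⟩ := Submodule.mkQ_surjective _ x
    by_cases hn : n = 0
    · exact Or.inl hn
    right
    rw [← map_smul, Submodule.mkQ_apply, Submodule.Quotient.mk_eq_zero] at hx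
    rw [Submodule.mkQ_apply, Submodule.Quotient.mk_eq_zero]
    exact hp x x.2 n hn hx
  let b1 := Module.finBasis ℤ (L'.submoduleOf L)
  let b2 := Module.finBasis ℤ (L ⧸ L'.submoduleOf L)
  let b := b1.sumQuot b2
  have hK := IsBasisMatrix.of_basis (b1.map (Submodule.submoduleOfEquivOfLe h))
  have hb := IsBasisMatrix.of_basis b
  refine ⟨_, _, _, Matrix.of fun x j => (b (Sum.inr j) : X → ℤ) x, hK, ?_⟩
  convert hb using 1
  ext x (i | j)
  · simp [b]
    rfl
  · simp

end Lattice
end TorsionGrowth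
end

noncomputable section

namespace TorsionGrowth

open Matrix Module

/-! ### Determinants of positive semidefinite matrices -/

section PosSemidef

variable {n : Type*} [Fintype n] [DecidableEq n]

theorem one_le_det_one_add {A : Matrix n n ℝ} (hA : A.PosSemidef) : 1 ≤ (1 + A).det := by
  have h : (1 + A).IsHermitian := (isHermitian_one).add hA.1
  rw [h.det_eq_prod_eigenvalues]
  have h1 : ∀ i, 1 ≤ h.eigenvalues i := fun i => by
    set v := (h.eigenvectorBasis i).ofLp with hv
    have hvv : star v ⬝ᵥ v = 1 := by
      have := h.eigenvectorBasis.orthonormal.1 i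
      rw [EuclideanSpace.norm_eq, Real.sqrt_eq_one] at this
      rw [← this]
      simp [dotProduct, v, sq]
    rw [h.eigenvalues_eq i, ← hv, Matrix.add_mulVec, dotProduct_add, one_mulVec, hvv]
    simpa using hA.dotProduct_mulVec_nonneg v
  simpa using Finset.prod_le_prod (s := Finset.univ) (f := fun _ => (1 : ℝ))
    (fun _ _ => zero_le_one) (fun i _ => h1 i)

open scoped MatrixOrder in
-- If `A = Mᴴ M` is invertible, then `B = Mᴴ (1 + N) M` with `N = M⁻¹ᴴ (B - A) M⁻¹` positive
-- semidefinite, and `1 + N` has all eigenvalues at least one.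
theorem det_le_det_of_posSemidef_sub {A B : Matrix n n ℝ} (hA : A.PosSemidef)
    (hAB : (B - A).PosSemidef) : A.det ≤ B.det := by
  have hB : B.PosSemidef := by simpa using hA.add hAB
  by_cases h0 : A.det = 0
  · rw [h0]
    exact hB.det_nonneg
  obtain ⟨M, hM⟩ := CStarAlgebra.nonneg_iff_eq_star_mul_self.mp hA.nonneg
  rw [star_eq_conjTranspose] at hM
  have hMu : IsUnit M.det := by
    refine isUnit_iff_ne_zero.mpr fun h => h0 ?_
    rw [hM, det_mul, h, mul_zero]
  have hC := hAB.conjTranspose_mul_mul_same M⁻¹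
  have h1 : B = Mᴴ * (1 + M⁻¹ᴴ * (B - A) * M⁻¹) * M := by
    have h2 : Mᴴ * M⁻¹ᴴ = 1 := by
      rw [← conjTranspose_mul, nonsing_inv_mul _ hMu, conjTranspose_one]
    rw [Matrix.mul_add, Matrix.add_mul, Matrix.mul_one, ← hM, Matrix.mul_assoc, Matrix.mul_assoc,
      Matrix.mul_assoc, nonsing_inv_mul _ hMu, Matrix.mul_one, ← Matrix.mul_assoc, h2,
      Matrix.one_mul, add_sub_cancel]
  have h3 : B.det = A.det * (1 + M⁻¹ᴴ * (B - A) * M⁻¹).det := by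
    rw [hM, det_mul]
    conv_lhs => rw [h1, det_mul, det_mul]
    rw [← hM]
    ring
  rw [h3]
  exact le_mul_of_one_le_right hA.det_nonneg (one_le_det_one_add hC)

end PosSemidef

/-! ### Covolumes of kernels and ranges of integral matrices -/

section Lattice

theorem map_intCast_mul {R l m n : Type*} [Ring R] [Fintype m] (A : Matrix l m ℤ)
    (B : Matrix m n ℤ) :
    (A * B).map (Int.cast : ℤ → R) = A.map (Int.cast : ℤ → R) * B.map (Int.cast : ℤ → R) :=
  Matrix.map_mul (f := Int.castRingHom R)

variable {X σ κ μ : Type*} [Fintype X] [Fintype κ] [DecidableEq κ] [Fintype μ] [DecidableEq μ]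
  [Fintype σ] [DecidableEq σ]

/-- After identifying the index types, `U` is square of determinant `±1`. This lets determinants be
computed in an adapted basis, indexed by a sum type, where they split into blocks. -/
theorem IsBasisMatrix.det_conj_of_top {R : Type*} [CommRing R] {U : Matrix σ κ ℤ}
    (hU : IsBasisMatrix U ⊤) (G : Matrix σ σ R) :
    ((U.map (Int.cast : ℤ → R))ᵀ * G * U.map (Int.cast : ℤ → R)).det = G.det := by
  have h1 : IsBasisMatrix (1 : Matrix σ σ ℤ) ⊤ := ⟨fun v h => by simpa using h, by simp⟩
  let e : σ ≃ κ := h1.basis.indexEquiv hU.basis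
  have hV := hU.reindex e
  have h2 : (U.submatrix id e).det ^ 2 = 1 := by
    have := h1.det_gram_eq hV
    rw [det_mul, det_mul, det_transpose, det_transpose, det_one, one_mul] at this
    rw [sq, ← this]
  rw [← det_submatrix_equiv_self e]
  have h3 : ((U.map (Int.cast : ℤ → R))ᵀ * G * U.map (Int.cast : ℤ → R)).submatrix e e
      = ((Int.castRingHom R).mapMatrix (U.submatrix id e))ᵀ * G
        * (Int.castRingHom R).mapMatrix (U.submatrix id e) := rfl
  rw [h3, det_mul, det_mul, det_transpose, ← RingHom.map_det, mul_right_comm, ← sq, ← map_pow, h2,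
    map_one, one_mul]

theorem posDef_gram {B : Matrix X κ ℤ} (hB : ∀ v, B *ᵥ v = 0 → v = 0) :
    ((Bᵀ * B).map (Int.cast : ℤ → ℝ)).PosDef := by
  have e : (B.map (Int.cast : ℤ → ℝ))ᴴ * B.map (Int.cast : ℤ → ℝ)
      = (Bᵀ * B).map (Int.cast : ℤ → ℝ) := by
    ext i j
    simp [Matrix.mul_apply]
  have h := (Matrix.posSemidef_conjTranspose_mul_self (B.map (Int.cast : ℤ → ℝ)))
  rw [e] at h
  rw [h.posDef_iff_det_ne_zero]
  have := (Int.castRingHom ℝ).map_det (Bᵀ * B)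
  rw [eq_intCast] at this
  change ((Int.castRingHom ℝ).mapMatrix (Bᵀ * B)).det ≠ 0
  rw [← this]
  exact_mod_cast (det_gram_pos hB).ne'

/-- Independence over `ℤ` survives in characteristic zero because the Gram determinant is a nonzero
integer. -/
theorem mulVec_map_intCast_injective {F : Type*} [Field F] [CharZero F] {B : Matrix X κ ℤ}
    (hB : ∀ v, B *ᵥ v = 0 → v = 0) : Function.Injective (B.map (Int.cast : ℤ → F)).mulVec := by
  have h : IsUnit ((Bᵀ * B).map (Int.cast : ℤ → F)) := by
    rw [isUnit_iff_isUnit_det, isUnit_iff_ne_zero]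
    change ((Int.castRingHom F).mapMatrix (Bᵀ * B)).det ≠ 0
    rw [← RingHom.map_det, eq_intCast]
    exact_mod_cast (det_gram_pos hB).ne'
  intro x y hxy
  refine Matrix.mulVec_injective_of_isUnit h ?_
  rw [map_intCast_mul, ← mulVec_mulVec, hxy, mulVec_mulVec]

theorem intCast_det_eq (M : Matrix κ κ ℤ) : ((M.det : ℤ) : ℝ) = (M.map (Int.cast : ℤ → ℝ)).det :=
  (Int.castRingHom ℝ).map_det M

/-- The kernel of an integral matrix `T` has a basis which extends to a basis of `ℤ^σ` by a
family mapped by `T` to a basis of its range. -/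
theorem exists_adapted_basis (T : Matrix X σ ℤ) :
    ∃ (r s : ℕ) (K : Matrix σ (Fin r) ℤ) (W : Matrix σ (Fin s) ℤ),
      IsBasisMatrix K (LinearMap.ker T.mulVecLin) ∧ IsBasisMatrix (fromCols K W) ⊤ ∧
      IsBasisMatrix (T * W) (LinearMap.range T.mulVecLin) := by
  obtain ⟨r, s, K, W, hK, hU⟩ := exists_isBasisMatrix_fromCols
    (L' := LinearMap.ker T.mulVecLin) (L := ⊤) le_top fun x _ n hn hx => by
      rw [LinearMap.mem_ker, map_smul] at hx
      exact (smul_eq_zero.mp hx).resolve_left hn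
  refine ⟨r, s, K, W, hK, hU, ⟨fun y hy => ?_, ?_⟩⟩
  · have h1 : W *ᵥ y ∈ LinearMap.ker T.mulVecLin := by
      rw [LinearMap.mem_ker, mulVecLin_apply, mulVec_mulVec, hy]
    obtain ⟨x, hx⟩ := hK.exists_mulVec_eq h1
    have := hU.eq_zero (Sum.elim (-x) y) (by
      rw [fromCols_mulVec]
      simp [mulVec_neg, hx])
    ext i
    simpa using congrFun this (Sum.inr i)
  · ext z
    constructor
    · rintro ⟨y, rfl⟩
      exact ⟨W *ᵥ y, by simp [mulVec_mulVec]⟩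
    · rintro ⟨v, rfl⟩
      obtain ⟨w, rfl⟩ := hU.exists_mulVec_eq (Submodule.mem_top (x := v))
      refine ⟨w ∘ Sum.inr, ?_⟩
      have h1 : T *ᵥ (K *ᵥ (w ∘ Sum.inl)) = 0 := hK.mulVec_mem (w ∘ Sum.inl)
      rw [mulVecLin_apply, mulVecLin_apply, fromCols_mulVec, mulVec_add, h1, zero_add,
        mulVec_mulVec]

/-- `Q` may have a kernel. Splitting `ℤ^σ` along it, `det G` is the determinant of `G` on the kernel
times that of the Schur complement `S`. The first factor is a positive integer, so it can be
dropped, and `S` dominates the Gram matrix of the range up to the factor `c`. -/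
theorem gdet_range_le {G : Matrix σ σ ℤ} (hG : (G.map (Int.cast : ℤ → ℝ)).PosDef)
    (Q : Matrix X σ ℤ) {c : ℝ} (hc : 1 ≤ c)
    (hQ : ∀ x : σ → ℝ, (Q.map (Int.cast : ℤ → ℝ) *ᵥ x) ⬝ᵥ (Q.map (Int.cast : ℤ → ℝ) *ᵥ x)
      ≤ c * (x ⬝ᵥ G.map (Int.cast : ℤ → ℝ) *ᵥ x)) :
    (gdet (LinearMap.range Q.mulVecLin) : ℝ) ≤ c ^ Fintype.card σ * G.det := by
  obtain ⟨r, s, K, W, hK, hU, hQW⟩ := exists_adapted_basis Q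
  have hs : s ≤ Fintype.card σ := by
    have h1 : IsBasisMatrix (1 : Matrix σ σ ℤ) ⊤ := ⟨fun v h => by simpa using h, by simp⟩
    have := Fintype.card_congr (h1.basis.indexEquiv hU.basis)
    simp at this
    omega
  set g := G.map (Int.cast : ℤ → ℝ) with hg
  set k := K.map (Int.cast : ℤ → ℝ) with hk
  set w := W.map (Int.cast : ℤ → ℝ) with hw
  set q := Q.map (Int.cast : ℤ → ℝ) with hq
  have hgT : gᵀ = g := hG.1
  have hkA : kᵀ * g * k = (Kᵀ * G * K).map (Int.cast : ℤ → ℝ) := by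
    rw [map_intCast_mul, map_intCast_mul, transpose_map]
  have hqw : (q * w)ᵀ * (q * w) = ((Q * W)ᵀ * (Q * W)).map (Int.cast : ℤ → ℝ) := by
    rw [map_intCast_mul, transpose_map, map_intCast_mul]
  have hqk : q * k = 0 := by
    have : Q * K = 0 := by
      refine Matrix.ext_of_mulVec_single fun i => ?_
      rw [← mulVec_mulVec, zero_mulVec]
      exact hK.mulVec_mem _
    rw [hq, hk, ← map_intCast_mul, this]
    simp
  set A := kᵀ * g * k with hA
  have hApd : A.PosDef :=
    hG.conjTranspose_mul_mul_same (mulVec_map_intCast_injective hK.eq_zero)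
  -- This is where integrality of `G` enters: a positive integer is at least one.
  have hAdet : 1 ≤ A.det := by
    have h1 := hApd.det_pos
    rw [hkA, ← intCast_det_eq] at h1 ⊢
    have : 0 < (Kᵀ * G * K).det := by exact_mod_cast h1
    exact_mod_cast this
  let _ : Invertible A := hApd.isUnit.invertible
  obtain ⟨S, hS⟩ : ∃ S, S = wᵀ * g * w - wᵀ * g * k * ⅟A * (kᵀ * g * w) := ⟨_, rfl⟩
  have hdet : (G.det : ℝ) = A.det * S.det := by
    rw [hS, intCast_det_eq, ← hU.det_conj_of_top, ← det_fromBlocks₁₁]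
    congr 1
    have : (fromCols K W).map (Int.cast : ℤ → ℝ) = fromCols k w := by
      ext i (j | j) <;> rfl
    rw [this, transpose_fromCols, fromRows_mul, fromRows_mul_fromCols]
  -- The columns of `w'` are those of `w` made `G`-orthogonal to the kernel. Their `G`-Gram matrix
  -- is `S`, while `q` does not notice the change.
  obtain ⟨w', hw'⟩ : ∃ w', w' = w - k * (⅟A * (kᵀ * g * w)) := ⟨_, rfl⟩
  have hkw' : kᵀ * g * w' = 0 := by
    rw [hw', Matrix.mul_sub, ← Matrix.mul_assoc (kᵀ * g), ← hA,
      ← Matrix.mul_assoc A, mul_invOf_self, Matrix.one_mul, sub_self]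
  have hSw : w'ᵀ * g * w' = S := by
    have h0 : w'ᵀ = wᵀ - (⅟A * (kᵀ * g * w))ᵀ * kᵀ := by
      rw [hw', transpose_sub, transpose_mul k]
    have h1 : w'ᵀ * g * w' = wᵀ * g * w' - (⅟A * (kᵀ * g * w))ᵀ * (kᵀ * g * w') := by
      rw [h0, Matrix.sub_mul, Matrix.sub_mul]
      simp only [Matrix.mul_assoc]
    rw [h1, hkw', Matrix.mul_zero, sub_zero, hw', Matrix.mul_sub, hS]
    simp only [Matrix.mul_assoc]
  have hqw' : q * w' = q * w := by
    rw [hw', Matrix.mul_sub, ← Matrix.mul_assoc q, hqk, Matrix.zero_mul,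
      sub_zero]
  have hcg : (c • g - qᵀ * q).PosSemidef := by
    refine PosSemidef.of_dotProduct_mulVec_nonneg ?_ fun x => ?_
    · rw [IsHermitian, conjTranspose_eq_transpose_of_trivial, transpose_sub, transpose_smul,
        transpose_mul, transpose_transpose, hgT]
    · rw [star_trivial, Matrix.sub_mulVec, dotProduct_sub, sub_nonneg, smul_mulVec,
        dotProduct_smul, smul_eq_mul, ← mulVec_mulVec, dotProduct_mulVec, vecMul_transpose]
      exact hQ x
  have hSpd : (c • S - (q * w)ᵀ * (q * w)).PosSemidef := by
    have := hcg.conjTranspose_mul_mul_same w'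
    convert this using 1
    rw [← hSw, ← hqw', conjTranspose_eq_transpose_of_trivial, Matrix.mul_sub, Matrix.sub_mul,
      Matrix.mul_smul, Matrix.smul_mul, transpose_mul]
    simp only [Matrix.mul_assoc]
  have h4 := det_le_det_of_posSemidef_sub (by
    simpa using posSemidef_conjTranspose_mul_self (q * w)) hSpd
  rw [det_smul, Fintype.card_fin] at h4
  have h5 : (gdet (LinearMap.range Q.mulVecLin) : ℝ) = ((q * w)ᵀ * (q * w)).det := by
    rw [hQW.gdet_eq, intCast_det_eq, hqw]
  rw [h5, hdet]
  have hSnn : 0 ≤ S.det := by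
    rw [← hSw]
    exact (hG.posSemidef.conjTranspose_mul_mul_same w').det_nonneg
  calc _ ≤ c ^ s * S.det := h4
    _ ≤ c ^ Fintype.card σ * S.det := by gcongr
    _ ≤ _ := by
      gcongr
      exact le_mul_of_one_le_left hSnn hAdet

/-- The orthogonal projection onto the span of the columns of `K`. -/
def columnProj (K : Matrix σ κ ℤ) : Matrix σ σ ℝ :=
  K.map (Int.cast : ℤ → ℝ) * ((Kᵀ * K).map (Int.cast : ℤ → ℝ))⁻¹ * (K.map (Int.cast : ℤ → ℝ))ᵀ

section columnProj

variable {K : Matrix σ κ ℤ} (hK : ∀ v, K *ᵥ v = 0 → v = 0)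
include hK

theorem columnProj_mul : columnProj K * K.map (Int.cast : ℤ → ℝ) = K.map (Int.cast : ℤ → ℝ) := by
  have h := (posDef_gram hK).isUnit
  rw [columnProj, Matrix.mul_assoc, ← transpose_map, ← map_intCast_mul, Matrix.mul_assoc,
    nonsing_inv_mul _ ((isUnit_iff_isUnit_det _).mp h), Matrix.mul_one]

theorem transpose_columnProj : (columnProj K)ᵀ = columnProj K := by
  rw [columnProj, transpose_mul, transpose_mul, transpose_transpose, transpose_nonsing_inv,
    ← transpose_map, transpose_mul, transpose_transpose, ← Matrix.mul_assoc]

theorem columnProj_mul_self : columnProj K * columnProj K = columnProj K := by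
  conv_lhs => arg 2; rw [columnProj]
  rw [Matrix.mul_assoc, ← Matrix.mul_assoc, columnProj_mul hK, ← Matrix.mul_assoc, columnProj]

theorem posSemidef_columnProj : (columnProj K).PosSemidef := by
  have := posSemidef_conjTranspose_mul_self (columnProj K)
  rwa [conjTranspose_eq_transpose_of_trivial, transpose_columnProj hK, columnProj_mul_self hK]
    at this

theorem posSemidef_one_sub_columnProj : (1 - columnProj K).PosSemidef := by
  have := posSemidef_conjTranspose_mul_self (1 - columnProj K)
  rwa [conjTranspose_eq_transpose_of_trivial, transpose_sub, transpose_columnProj hK,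
    transpose_one, Matrix.sub_mul, Matrix.one_mul, Matrix.mul_sub, Matrix.mul_one,
    columnProj_mul_self hK, sub_self, sub_zero] at this

end columnProj

/-- Adding the orthogonal projection onto the kernel replaces the eigenvalue zero of `Tᵀ T` by one.
In an adapted basis the kernel block is the Gram matrix of the kernel, and its Schur complement is
the Gram matrix of the range. The statement about `ℂ` says that the complex kernel is spanned by the
integral one. -/
theorem exists_det_transpose_mul_self_add_columnProj (T : Matrix X σ ℤ) :
    ∃ (r : ℕ) (K : Matrix σ (Fin r) ℤ), IsBasisMatrix K (LinearMap.ker T.mulVecLin) ∧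
      (∀ x : σ → ℂ, T.map (Int.cast : ℤ → ℂ) *ᵥ x = 0 → ∃ y, K.map (Int.cast : ℤ → ℂ) *ᵥ y = x) ∧
      ((T.map (Int.cast : ℤ → ℝ))ᵀ * T.map (Int.cast : ℤ → ℝ) + columnProj K).det
        = gdet (LinearMap.ker T.mulVecLin) * gdet (LinearMap.range T.mulVecLin) := by
  obtain ⟨r, s, K', W, hK', hU, hTW⟩ := exists_adapted_basis T
  refine ⟨r, K', hK', fun x hx => ?_, ?_⟩
  · obtain ⟨V, hV⟩ := hU.exists_mul_eq (B' := (1 : Matrix σ σ ℤ)) fun v => Submodule.mem_top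
    have hx' : (fromCols K' W).map (Int.cast : ℤ → ℂ) *ᵥ (V.map (Int.cast : ℤ → ℂ) *ᵥ x) = x := by
      rw [mulVec_mulVec, ← map_intCast_mul, ← hV, Matrix.map_one _ Int.cast_zero Int.cast_one,
        one_mulVec]
    have hKW : (fromCols K' W).map (Int.cast : ℤ → ℂ)
        = fromCols (K'.map (Int.cast : ℤ → ℂ)) (W.map (Int.cast : ℤ → ℂ)) := by
      ext i (j | j) <;> rfl
    have hTK : T * K' = 0 := by
      refine Matrix.ext_of_mulVec_single fun i => ?_
      rw [← mulVec_mulVec, zero_mulVec]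
      exact hK'.mulVec_mem _
    set v := V.map (Int.cast : ℤ → ℂ) *ᵥ x
    rw [hKW, fromCols_mulVec] at hx'
    have h2 : (T * W).map (Int.cast : ℤ → ℂ) *ᵥ (v ∘ Sum.inr) = 0 := by
      rw [← hx', mulVec_add, mulVec_mulVec, mulVec_mulVec, ← map_intCast_mul, ← map_intCast_mul,
        hTK] at hx
      simpa using hx
    have h3 := mulVec_map_intCast_injective hTW.eq_zero (h2.trans (mulVec_zero _).symm)
    rw [h3, mulVec_zero, add_zero] at hx'
    exact ⟨_, hx'⟩
  set t := T.map (Int.cast : ℤ → ℝ) with ht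
  set k := K'.map (Int.cast : ℤ → ℝ) with hk
  set w := W.map (Int.cast : ℤ → ℝ) with hw
  have htk : t * k = 0 := by
    have : T * K' = 0 := by
      refine Matrix.ext_of_mulVec_single fun i => ?_
      rw [← mulVec_mulVec, zero_mulVec]
      exact hK'.mulVec_mem _
    rw [ht, hk, ← map_intCast_mul, this]
    simp
  have hpk : columnProj K' * k = k := columnProj_mul hK'.eq_zero
  have hkp : kᵀ * columnProj K' = kᵀ := by
    rw [← transpose_columnProj hK'.eq_zero, ← transpose_mul, hpk]
  have hkt : kᵀ * tᵀ = 0 := by rw [← transpose_mul, htk, transpose_zero]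
  set A := (K'ᵀ * K').map (Int.cast : ℤ → ℝ) with hA
  have hAk : A = kᵀ * k := by rw [hA, map_intCast_mul, transpose_map]
  let _ : Invertible A := (posDef_gram hK'.eq_zero).isUnit.invertible
  have hpw : columnProj K' = k * ⅟A * kᵀ := by
    rw [columnProj, ← hA, invOf_eq_nonsing_inv]
  have hB : ((T * W)ᵀ * (T * W)).map (Int.cast : ℤ → ℝ) = (t * w)ᵀ * (t * w) := by
    rw [map_intCast_mul, transpose_map, map_intCast_mul]
  rw [hK'.gdet_eq, hTW.gdet_eq, intCast_det_eq, intCast_det_eq, hB, ← hA,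
    ← hU.det_conj_of_top]
  have : (fromCols K' W).map (Int.cast : ℤ → ℝ) = fromCols k w := by
    ext i (j | j) <;> rfl
  rw [this, transpose_fromCols, fromRows_mul, fromRows_mul_fromCols]
  have e1 : kᵀ * (tᵀ * t + columnProj K') = kᵀ := by
    rw [Matrix.mul_add, hkp, ← Matrix.mul_assoc, hkt, Matrix.zero_mul, zero_add]
  have e2 : wᵀ * (tᵀ * t + columnProj K') * k = wᵀ * k := by
    rw [Matrix.mul_assoc, Matrix.add_mul, hpk, Matrix.mul_assoc, htk, Matrix.mul_zero, zero_add]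
  rw [e1, e2, ← hAk, det_fromBlocks₁₁]
  -- In the Schur complement the contribution of the projection cancels, leaving `(t w)ᵀ (t w)`.
  congr 2
  rw [Matrix.mul_add, Matrix.add_mul, hpw, transpose_mul]
  simp only [Matrix.mul_assoc, add_sub_cancel_right]

/-- `Tᵀ T` plus the projection onto the kernel is at most `c + 1`, and its determinant is the
squared covolume of the kernel times that of the range; the latter is a positive integer. -/
theorem gdet_ker_le (T : Matrix X σ ℤ) {c : ℝ}
    (hT : ∀ x : σ → ℝ, (T.map (Int.cast : ℤ → ℝ) *ᵥ x) ⬝ᵥ (T.map (Int.cast : ℤ → ℝ) *ᵥ x)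
      ≤ c * (x ⬝ᵥ x)) :
    (gdet (LinearMap.ker T.mulVecLin) : ℝ) ≤ (c + 1) ^ Fintype.card σ := by
  obtain ⟨r, K, hK, -, h1⟩ := exists_det_transpose_mul_self_add_columnProj T
  set t := T.map (Int.cast : ℤ → ℝ)
  have hP := posSemidef_columnProj hK.eq_zero
  have ht : (tᵀ * t).PosSemidef := posSemidef_conjTranspose_mul_self t
  have h2 : (c • (1 : Matrix σ σ ℝ) - tᵀ * t).PosSemidef := by
    refine PosSemidef.of_dotProduct_mulVec_nonneg ?_ fun x => ?_
    · rw [IsHermitian, conjTranspose_eq_transpose_of_trivial, transpose_sub, transpose_smul,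
        transpose_mul, transpose_transpose, transpose_one]
    · rw [star_trivial, Matrix.sub_mulVec, dotProduct_sub, sub_nonneg, smul_mulVec,
        dotProduct_smul, smul_eq_mul, ← mulVec_mulVec, dotProduct_mulVec, vecMul_transpose,
        one_mulVec]
      exact hT x
  have h3 : ((c + 1) • (1 : Matrix σ σ ℝ) - (tᵀ * t + columnProj K)).PosSemidef := by
    convert h2.add (posSemidef_one_sub_columnProj hK.eq_zero) using 1
    rw [add_smul, one_smul]
    abel
  have h4 := det_le_det_of_posSemidef_sub (ht.add hP) h3
  rw [h1, det_smul, det_one, mul_one] at h4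
  refine le_trans ?_ h4
  have h5 : (1 : ℝ) ≤ gdet (LinearMap.range T.mulVecLin) := by
    exact_mod_cast gdet_pos (LinearMap.range T.mulVecLin)
  have h6 : (0 : ℝ) ≤ gdet (LinearMap.ker T.mulVecLin) := by
    exact_mod_cast (gdet_pos (LinearMap.ker T.mulVecLin)).le
  exact le_mul_of_one_le_right h6 h5

end Lattice
end TorsionGrowth
end

noncomputable section

namespace TorsionGrowth

open Matrix Module

/-! ### The geometric determinant of an integral matrix -/

section GeomDet

variable {X σ : Type*} [Fintype X] [Fintype σ] [DecidableEq σ] [DecidableEq X]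

theorem geomDet_pos {V W : Type*} [NormedAddCommGroup V] [InnerProductSpace ℂ V]
    [FiniteDimensional ℂ V] [NormedAddCommGroup W] [InnerProductSpace ℂ W]
    [FiniteDimensional ℂ W] (f : V →ₗ[ℂ] W) : 0 < BasedComplex.geomDet f := by
  rw [BasedComplex.geomDet, Finsupp.prod]
  exact Finset.prod_pos fun i hi =>
    (f.singularValues_pos_iff_ne_zero i).mpr (Finsupp.mem_support_iff.mp hi)

/-- Zero eigenvalues are replaced by one so that the product runs over a full eigenbasis and can be
read as a determinant. -/
theorem geomDet_sq_eq_prod {V W : Type*} [NormedAddCommGroup V] [InnerProductSpace ℂ V]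
    [FiniteDimensional ℂ V] [NormedAddCommGroup W] [InnerProductSpace ℂ W]
    [FiniteDimensional ℂ W] (f : V →ₗ[ℂ] W) :
    BasedComplex.geomDet f ^ 2 = ∏ i, if f.isSymmetric_adjoint_comp_self.eigenvalues rfl i = 0
      then 1 else f.isSymmetric_adjoint_comp_self.eigenvalues rfl i := by
  have h1 : BasedComplex.geomDet f
      = ∏ i ∈ Finset.range (finrank ℂ V), if f.singularValues i = 0 then 1 else f.singularValues i := by
    rw [BasedComplex.geomDet, Finsupp.prod]
    have hsub : f.singularValues.support ⊆ Finset.range (finrank ℂ V) := fun i hi => by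
      by_contra h
      exact Finsupp.mem_support_iff.mp hi
        (f.singularValues_of_finrank_le (by simpa using h))
    rw [← Finset.prod_subset hsub]
    · refine Finset.prod_congr rfl fun i hi => ?_
      rw [if_neg (Finsupp.mem_support_iff.mp hi)]
    · intro i _ hi
      rw [if_pos (Finsupp.notMem_support_iff.mp hi)]
  rw [h1, Finset.prod_range, ← Finset.prod_pow]
  refine Finset.prod_congr rfl fun i _ => ?_
  rw [← f.sq_singularValues_fin rfl i]
  by_cases h : f.singularValues i = 0 <;> simp [h]

open scoped ComplexOrder in
-- An eigenbasis of `Tᴴ T` also diagonalizes `Tᴴ T` plus the projection onto the kernel: the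
-- projection fixes the eigenvectors for zero and kills the others, which lie in the range of `Tᴴ`.
theorem geomDet_sq_eq_gdet_mul_gdet (T : Matrix X σ ℤ) :
    BasedComplex.geomDet (Matrix.toEuclideanLin (T.map (Int.castRingHom ℂ))) ^ 2
      = gdet (LinearMap.ker T.mulVecLin) * gdet (LinearMap.range T.mulVecLin) := by
  obtain ⟨r, K, hK, hker, hdet⟩ := exists_det_transpose_mul_self_add_columnProj T
  rw [← hdet, geomDet_sq_eq_prod]
  set f := Matrix.toEuclideanLin (T.map (Int.castRingHom ℂ)) with hf
  set hs := f.isSymmetric_adjoint_comp_self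
  set M := (T.map (Int.cast : ℤ → ℝ))ᵀ * T.map (Int.cast : ℤ → ℝ) + columnProj K with hM
  let b := hs.eigenvectorBasis rfl
  set t := T.map (Int.cast : ℤ → ℂ) with ht
  let p := (columnProj K).map (Complex.ofReal)
  have hMC : M.map Complex.ofReal = tᴴ * t + p := by
    ext i j
    simp [hM, p, ht, Matrix.mul_apply]
  have hadj : LinearMap.adjoint f ∘ₗ f = Matrix.toEuclideanLin (tᴴ * t) := by
    rw [hf, ← Matrix.toEuclideanLin_conjTranspose_eq_adjoint]
    ext x
    simp [ht, Matrix.toLpLin_apply, mulVec_mulVec]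
  have hKC : K.map (Int.cast : ℤ → ℂ) = (K.map (Int.cast : ℤ → ℝ)).map Complex.ofRealHom := by
    ext i j
    simp
  have hpk : ∀ y, p *ᵥ (K.map (Int.cast : ℤ → ℂ) *ᵥ y) = K.map (Int.cast : ℤ → ℂ) *ᵥ y := by
    intro y
    change (columnProj K).map Complex.ofRealHom *ᵥ _ = _
    rw [mulVec_mulVec, hKC, ← Matrix.map_mul (f := Complex.ofRealHom), columnProj_mul hK.eq_zero]
  have hpt : p * tᴴ = 0 := by
    have h1 : columnProj K * (T.map (Int.cast : ℤ → ℝ))ᵀ = 0 := by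
      have h2 : T * K = 0 := by
        refine Matrix.ext_of_mulVec_single fun i => ?_
        rw [← mulVec_mulVec, zero_mulVec]
        exact hK.mulVec_mem _
      rw [columnProj, Matrix.mul_assoc, ← transpose_mul, ← map_intCast_mul, h2]
      simp
    have h2 : tᴴ = ((T.map (Int.cast : ℤ → ℝ))ᵀ).map Complex.ofRealHom := by
      ext i j
      simp [ht]
    change (columnProj K).map Complex.ofRealHom * tᴴ = 0
    rw [h2, ← Matrix.map_mul, h1]
    simp
  have key : ∀ i, Matrix.toEuclideanLin (M.map Complex.ofReal) (b i)
      = ((if hs.eigenvalues rfl i = 0 then 1 else hs.eigenvalues rfl i : ℝ) : ℂ) • b i := by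
    intro i
    have hb : (tᴴ * t) *ᵥ (b i).ofLp = (hs.eigenvalues rfl i : ℂ) • (b i).ofLp := by
      have := hs.apply_eigenvectorBasis rfl i
      exact congrArg WithLp.ofLp ((LinearMap.congr_fun hadj (b i)).symm.trans this)
    have hgoal : (M.map Complex.ofReal) *ᵥ (b i).ofLp
        = ((if hs.eigenvalues rfl i = 0 then 1 else hs.eigenvalues rfl i : ℝ) : ℂ)
          • (b i).ofLp := by
      rw [hMC, Matrix.add_mulVec, hb]
      split_ifs with h0
      · rw [h0] at hb ⊢
        have h1 : t *ᵥ (b i).ofLp = 0 := by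
          rw [← Matrix.conjTranspose_mul_self_mulVec_eq_zero, hb]
          simp
        obtain ⟨y, hy⟩ := hker _ h1
        rw [← hy, hpk]
        simp
      · have h2 : p *ᵥ ((hs.eigenvalues rfl i : ℂ) • (b i).ofLp) = 0 := by
          rw [← hb, mulVec_mulVec, ← Matrix.mul_assoc, hpt, Matrix.zero_mul, zero_mulVec]
        rw [mulVec_smul] at h2
        rw [(smul_eq_zero.mp h2).resolve_left (by exact_mod_cast h0), add_zero]
    exact congrArg (WithLp.toLp 2) hgoal
  have h3 : LinearMap.det (Matrix.toEuclideanLin (M.map Complex.ofReal)) = (M.map Complex.ofReal).det := by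
    change LinearMap.det (Matrix.toLpLin 2 2 (M.map Complex.ofReal)) = _
    rw [Matrix.toLpLin_eq_toLin, LinearMap.det_toLin]
  have h4 : LinearMap.det (Matrix.toEuclideanLin (M.map Complex.ofReal))
      = ∏ i, ((if hs.eigenvalues rfl i = 0 then 1 else hs.eigenvalues rfl i : ℝ) : ℂ) := by
    rw [← LinearMap.det_toMatrix b.toBasis, ← det_diagonal]
    congr 1
    ext i j
    rw [LinearMap.toMatrix_apply, b.coe_toBasis, key, map_smul, ← b.coe_toBasis, Basis.repr_self,
      Finsupp.smul_apply, smul_eq_mul, Matrix.diagonal_apply]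
    rcases eq_or_ne i j with rfl | hij
    · rw [if_pos rfl, Finsupp.single_eq_same, mul_one]
    · rw [if_neg hij, Finsupp.single_eq_of_ne hij, mul_zero]
  have h5 : ((M.det : ℝ) : ℂ) = (M.map Complex.ofReal).det := Complex.ofRealHom.map_det M
  rw [← Complex.ofReal_inj, h5, ← h3, h4, Complex.ofReal_prod]

end GeomDet
end TorsionGrowth
end

noncomputable section

namespace TorsionGrowth

open Matrix Module

/-! ### Covolumes of cycles, boundaries and harmonic chains -/

section Harmonic

variable {X σ ρ : Type*} [Fintype X] [Fintype σ] [Fintype ρ]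

theorem exists_smul_mem_of_forall_exists {L' L : Submodule ℤ (X → ℤ)}
    (hf : ∀ x ∈ L, ∃ n : ℤ, n ≠ 0 ∧ n • x ∈ L') : ∃ n : ℤ, n ≠ 0 ∧ ∀ x ∈ L, n • x ∈ L' := by
  obtain ⟨r, B, hB⟩ := exists_isBasisMatrix L
  choose n hn hnB using fun j : Fin r => hf _ (hB.mulVec_mem (Pi.single j 1))
  refine ⟨∏ j, n j, Finset.prod_ne_zero_iff.mpr fun j _ => hn j, fun x hx => ?_⟩
  obtain ⟨v, rfl⟩ := hB.exists_mulVec_eq hx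
  have hv : v = ∑ j, v j • Pi.single j (1 : ℤ) := by
    ext i
    simp [Finset.sum_apply, Pi.single_apply]
  rw [← mulVecLin_apply, hv, map_sum, Finset.smul_sum]
  refine Submodule.sum_mem _ fun j _ => ?_
  rw [map_smul, smul_comm, ← Finset.mul_prod_erase _ _ (Finset.mem_univ j), mul_comm, mul_smul]
  exact Submodule.smul_mem _ _ (Submodule.smul_mem _ _ (hnB j))

theorem finrank_eq_of_forall_exists_smul_mem {L' L : Submodule ℤ (X → ℤ)} (h : L' ≤ L)
    (hf : ∀ x ∈ L, ∃ n : ℤ, n ≠ 0 ∧ n • x ∈ L') : finrank ℤ L' = finrank ℤ L := by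
  obtain ⟨n, hn, hL⟩ := exists_smul_mem_of_forall_exists hf
  refine le_antisymm (LinearMap.finrank_le_finrank_of_injective
    (Submodule.inclusion_injective h)) ?_
  refine LinearMap.finrank_le_finrank_of_injective
    (f := ((LinearMap.lsmul ℤ (X → ℤ) n).restrict hL : L →ₗ[ℤ] L')) ?_
  intro x y hxy
  have := congrArg Subtype.val hxy
  exact Subtype.ext (smul_right_injective _ hn this)

theorem gdet_eq_card_sq_mul_of_forall_exists_smul_mem {L' L : Submodule ℤ (X → ℤ)} (h : L' ≤ L)
    (hf : ∀ x ∈ L, ∃ n : ℤ, n ≠ 0 ∧ n • x ∈ L') :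
    gdet L' = (Nat.card (L ⧸ L'.submoduleOf L) : ℤ) ^ 2 * gdet L := by
  have hr := finrank_eq_of_forall_exists_smul_mem h hf
  have hB := IsBasisMatrix.of_basis (Module.finBasis ℤ L)
  have hB' := IsBasisMatrix.of_basis (Module.finBasis ℤ L')
  exact hB.gdet_eq_card_sq_mul (hB'.reindex (finCongr hr.symm)) h

/-- The squared index is a positive integer. A finite-index sublattice therefore bounds the covolume
from above, whatever its index. -/
theorem gdet_le_of_forall_exists_smul_mem {L' L : Submodule ℤ (X → ℤ)} (h : L' ≤ L)
    (hf : ∀ x ∈ L, ∃ n : ℤ, n ≠ 0 ∧ n • x ∈ L') : gdet L ≤ gdet L' := by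
  have h1 := gdet_eq_card_sq_mul_of_forall_exists_smul_mem h hf
  have h2 := gdet_pos L'
  have h3 := gdet_pos L
  have h4 : 0 < (Nat.card (L ⧸ L'.submoduleOf L) : ℤ) ^ 2 := by
    by_contra hneg
    rw [h1] at h2
    nlinarith
  rw [h1]
  nlinarith

/-- The elements of `L` with a nonzero multiple in `B`. -/
def saturationIn (B L : Submodule ℤ (X → ℤ)) : Submodule ℤ (X → ℤ) where
  carrier := {x | x ∈ L ∧ ∃ n : ℤ, n ≠ 0 ∧ n • x ∈ B}
  zero_mem' := ⟨L.zero_mem, 1, one_ne_zero, by simp⟩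
  add_mem' := by
    rintro x y ⟨hx, n, hn, hnx⟩ ⟨hy, m, hm, hmy⟩
    refine ⟨L.add_mem hx hy, n * m, mul_ne_zero hn hm, ?_⟩
    rw [smul_add, mul_smul, mul_smul, smul_comm n m x]
    exact B.add_mem (B.smul_mem m hnx) (B.smul_mem n hmy)
  smul_mem' := by
    rintro c x ⟨hx, n, hn, hnx⟩
    exact ⟨L.smul_mem c hx, n, hn, by rw [smul_comm]; exact B.smul_mem c hnx⟩

/-- The torsion of `L / B` is the image of the saturation of `B`, so its order is the index of `B`
in that saturation. -/
theorem gdet_eq_card_torsion_sq_mul {B L : Submodule ℤ (X → ℤ)} (h : B ≤ L) :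
    gdet B = (Nat.card (Submodule.torsion ℤ (L ⧸ B.submoduleOf L)) : ℤ) ^ 2
      * gdet (saturationIn B L) := by
  have hBS : B ≤ saturationIn B L := fun x hx => ⟨h hx, 1, one_ne_zero, by simpa using hx⟩
  have hSL : saturationIn B L ≤ L := fun x hx => hx.1
  rw [gdet_eq_card_sq_mul_of_forall_exists_smul_mem hBS fun x hx => hx.2]
  congr 3
  let φ : ↥(saturationIn B L) →ₗ[ℤ] L ⧸ B.submoduleOf L :=
    (B.submoduleOf L).mkQ ∘ₗ Submodule.inclusion hSL
  have hker : LinearMap.ker φ = B.submoduleOf (saturationIn B L) := by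
    ext x
    rw [LinearMap.mem_ker, LinearMap.comp_apply, Submodule.mkQ_apply,
      Submodule.Quotient.mk_eq_zero]
    rfl
  have hrange : LinearMap.range φ = Submodule.torsion ℤ (L ⧸ B.submoduleOf L) := by
    ext y
    obtain ⟨x, rfl⟩ := Submodule.mkQ_surjective _ y
    rw [Submodule.mem_torsion_iff]
    constructor
    · rintro ⟨z, hz⟩
      obtain ⟨n, hn, hnz⟩ := z.2.2
      refine ⟨⟨n, mem_nonZeroDivisors_of_ne_zero hn⟩, ?_⟩
      rw [← hz]
      change n • (B.submoduleOf L).mkQ (Submodule.inclusion hSL z) = 0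
      rw [← map_smul, Submodule.mkQ_apply, Submodule.Quotient.mk_eq_zero]
      exact hnz
    · rintro ⟨n, hn⟩
      change (n : ℤ) • (B.submoduleOf L).mkQ x = 0 at hn
      rw [← map_smul, Submodule.mkQ_apply, Submodule.Quotient.mk_eq_zero] at hn
      exact ⟨⟨x, x.2, n, nonZeroDivisors.coe_ne_zero n, hn⟩, rfl⟩
  rw [← hker, ← hrange]
  exact Nat.card_congr φ.quotKerEquivRange.toEquiv

theorem dotProduct_eq_zero_of_mem_saturationIn {D : Matrix X σ ℤ} {L : Submodule ℤ (X → ℤ)}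
    {x y : X → ℤ} (hx : x ∈ saturationIn (LinearMap.range D.mulVecLin) L)
    (hy : Dᵀ *ᵥ y = 0) : x ⬝ᵥ y = 0 := by
  obtain ⟨-, n, hn, w, hw⟩ := hx
  rw [mulVecLin_apply] at hw
  have : n • (x ⬝ᵥ y) = 0 := by
    rw [← smul_dotProduct, ← hw, dotProduct_comm, dotProduct_mulVec, ← mulVec_transpose, hy,
      zero_dotProduct]
  exact (smul_eq_zero.mp this).resolve_left hn

/-- The covolumes of the cycles and of the saturation of the boundaries agree up to the covolume
of the harmonic chains. -/
theorem gdet_ker_le_and_gdet_saturationIn_le [DecidableEq σ] (D : Matrix X σ ℤ) (E : Matrix ρ X ℤ)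
    (hED : E * D = 0) :
    gdet (LinearMap.ker E.mulVecLin)
      ≤ gdet (saturationIn (LinearMap.range D.mulVecLin) (LinearMap.ker E.mulVecLin))
        * gdet (LinearMap.ker E.mulVecLin ⊓ LinearMap.ker Dᵀ.mulVecLin) ∧
    gdet (saturationIn (LinearMap.range D.mulVecLin) (LinearMap.ker E.mulVecLin))
      ≤ gdet (LinearMap.ker E.mulVecLin)
        * gdet (LinearMap.ker E.mulVecLin ⊓ LinearMap.ker Dᵀ.mulVecLin) := by
  set Z := LinearMap.ker E.mulVecLin with hZ
  set B := LinearMap.range D.mulVecLin with hB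
  set H := Z ⊓ LinearMap.ker Dᵀ.mulVecLin with hH
  set S := saturationIn B Z with hS
  have hBZ : B ≤ Z := by
    rintro _ ⟨w, rfl⟩
    rw [hZ, LinearMap.mem_ker, mulVecLin_apply, mulVecLin_apply, mulVec_mulVec, hED, zero_mulVec]
  have hSZ : S ≤ Z := fun x hx => hx.1
  have hSH : ∀ x ∈ S, ∀ y ∈ H, x ⬝ᵥ y = 0 := fun x hx y hy =>
    dotProduct_eq_zero_of_mem_saturationIn hx hy.2
  obtain ⟨r, s, K, W, hK, hKW⟩ := exists_isBasisMatrix_fromCols hSZ fun x hx n hn hnx => by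
    obtain ⟨-, m, hm, hmx⟩ := hnx
    exact ⟨hx, m * n, mul_ne_zero hm hn, by rwa [mul_smul]⟩
  obtain ⟨h, V, hV⟩ := exists_isBasisMatrix H
  have hKV : IsBasisMatrix (fromCols K V) (S ⊔ H) := by
    constructor
    · intro v hv
      rw [fromCols_mulVec] at hv
      have h1 : K *ᵥ (v ∘ Sum.inl) = 0 := by
        refine dotProduct_self_eq_zero.mp ?_
        conv_lhs => arg 2; rw [eq_neg_of_add_eq_zero_left hv]
        rw [dotProduct_neg, hSH _ (hK.mulVec_mem _) _ (hV.mulVec_mem _), neg_zero]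
      rw [h1, zero_add] at hv
      have h2 := hK.eq_zero _ h1
      have h3 := hV.eq_zero _ hv
      ext (i | i)
      · exact congrFun h2 i
      · exact congrFun h3 i
    · ext x
      rw [Submodule.mem_sup]
      constructor
      · rintro ⟨v, rfl⟩
        exact ⟨_, hK.mulVec_mem (v ∘ Sum.inl), _, hV.mulVec_mem (v ∘ Sum.inr),
          (fromCols_mulVec ..).symm⟩
      · rintro ⟨y, hy, z, hz, rfl⟩
        obtain ⟨a, rfl⟩ := hK.exists_mulVec_eq hy
        obtain ⟨b, rfl⟩ := hV.exists_mulVec_eq hz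
        exact ⟨Sum.elim a b, by rw [mulVecLin_apply, fromCols_mulVec]; simp⟩
  have hle : S ⊔ H ≤ Z := sup_le hSZ inf_le_left
  have hfin : ∀ x ∈ Z, ∃ n : ℤ, n ≠ 0 ∧ n • x ∈ S ⊔ H := by
    intro x hx
    -- The orthogonal projection of `x` to the span of `S` is rational with denominator dividing
    -- `det (Kᵀ K)`; the adjugate clears it. What remains of the multiple of `x` is harmonic.
    refine ⟨(Kᵀ * K).det, (det_gram_pos hK.eq_zero).ne', ?_⟩
    set u := K *ᵥ ((Kᵀ * K).adjugate *ᵥ (Kᵀ *ᵥ x)) with hu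
    have huS : u ∈ S := hK.mulVec_mem _
    have h1 : Kᵀ *ᵥ ((Kᵀ * K).det • x - u) = 0 := by
      rw [mulVec_sub, hu, mulVec_mulVec, mulVec_mulVec, mul_adjugate, mulVec_smul, smul_mulVec,
        one_mulVec, sub_self]
    refine Submodule.mem_sup.mpr ⟨u, huS, (Kᵀ * K).det • x - u, ⟨?_, ?_⟩, by abel⟩
    · exact Z.sub_mem (Z.smul_mem _ hx) (hSZ huS)
    · obtain ⟨Q, hQ⟩ := hK.exists_mul_eq (B' := D) fun v =>
        ⟨hBZ ⟨v, rfl⟩, 1, one_ne_zero, by rw [one_smul]; exact ⟨v, rfl⟩⟩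
      change Dᵀ *ᵥ _ = 0
      rw [hQ, transpose_mul, ← mulVec_mulVec, h1, mulVec_zero]
  have hrs : r + h = r + s := by
    have h1 := finrank_eq_of_forall_exists_smul_mem hle hfin
    rw [finrank_eq_card_basis hKV.basis, finrank_eq_card_basis hKW.basis] at h1
    simpa using h1
  obtain rfl : h = s := by omega
  have hKV0 : Kᵀ * V = 0 := by
    ext i j
    have := hSH _ (hK.mulVec_mem (Pi.single i 1)) _ (hV.mulVec_mem (Pi.single j 1))
    rw [mulVec_single_one, mulVec_single_one] at this
    exact this
  have hprod : gdet (S ⊔ H) = gdet S * gdet H := by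
    rw [hKV.gdet_eq, hK.gdet_eq, hV.gdet_eq, transpose_fromCols, fromRows_mul_fromCols]
    rw [hKV0, det_fromBlocks_zero₁₂]
  have hVK : Vᵀ * K = 0 := by
    rw [← transpose_transpose (Vᵀ * K), transpose_mul, transpose_transpose, hKV0, transpose_zero]
  obtain ⟨P, hP⟩ := hKW.exists_mul_eq (fun v => hle (hKV.mulVec_mem v))
  have hPdet : gdet (S ⊔ H) = P.det ^ 2 * gdet Z := by
    rw [hKV.gdet_eq, hKW.gdet_eq, hP, det_gram_mul]
  -- The matrix of scalar products between a basis of `S ⊔ H` and one of `Z` is evaluated in two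
  -- ways: as a block triangular matrix, and through the change of basis `P`.
  have hmix : gdet S * (Vᵀ * W).det = P.det * gdet Z := by
    have h1 : ((fromCols K V)ᵀ * fromCols K W).det = gdet S * (Vᵀ * W).det := by
      rw [transpose_fromCols, fromRows_mul_fromCols, hVK, det_fromBlocks_zero₂₁, hK.gdet_eq]
    rw [← h1, hP, transpose_mul, Matrix.mul_assoc, det_mul, det_transpose, hKW.gdet_eq]
  have pS := gdet_pos S
  have pH := gdet_pos H
  have pZ := gdet_pos Z
  refine ⟨?_, ?_⟩
  · rw [← hprod]
    exact gdet_le_of_forall_exists_smul_mem hle hfin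
  -- Eliminating `P.det` leaves the square of `det (Vᵀ W)`, an integer that is nonzero by positivity
  -- of the right-hand side, hence at least one after squaring.
  · have h1 : gdet S * (Vᵀ * W).det ^ 2 = gdet Z * gdet H := by
      have h2 : gdet S * (gdet S * (Vᵀ * W).det ^ 2) = gdet S * (gdet Z * gdet H) := by
        linear_combination (gdet S * (Vᵀ * W).det + P.det * gdet Z) * hmix
          + gdet Z * hprod - gdet Z * hPdet
      exact mul_left_cancel₀ pS.ne' h2
    have h3 : 0 < (Vᵀ * W).det ^ 2 := by
      by_contra hneg
      nlinarith [mul_pos pZ pH]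
    nlinarith

end Harmonic
end TorsionGrowth
end

noncomputable section

namespace TorsionGrowth

open Matrix Module

/-! ### The difference of the two torsions of a based free complex over `ℤ` -/

namespace BasedComplex

variable (E : BasedComplex ℤ)

/-- The lattice of integral harmonic chains. -/
def harmonic (k : ℕ) : Submodule ℤ (E.ι k → ℤ) :=
  E.cycles k ⊓ LinearMap.ker (E.d k)ᵀ.mulVecLin

theorem exists_cycles_eq_ker {R : Type*} [CommRing R] (E : BasedComplex R) (k : ℕ) :
    ∃ (ρ : Type) (_ : Fintype ρ) (A : Matrix ρ (E.ι k) R),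
      A * E.d k = 0 ∧ E.cycles k = LinearMap.ker A.mulVecLin := by
  cases k with
  | zero => exact ⟨Empty, inferInstance, 0, Matrix.zero_mul _, by simp [cycles]⟩
  | succ k => exact ⟨E.ι k, inferInstance, E.d k, E.d_mul_d k, rfl⟩

/-- Removing the torsion replaces the boundaries by their saturation, which is then compared with
the cycles. Positivity of the cardinality records that the torsion is finite. -/
theorem abs_log_card_torsion_le (k : ℕ) :
    0 < Nat.card (Submodule.torsion ℤ (E.Homology k)) ∧
    |Real.log (gdet (E.boundaries k)) - Real.log (gdet (E.cycles k))
        - 2 * Real.log (Nat.card (Submodule.torsion ℤ (E.Homology k)))|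
      ≤ Real.log (gdet (E.harmonic k)) := by
  obtain ⟨ρ, _, A, hA, hZ⟩ := E.exists_cycles_eq_ker k
  obtain ⟨h1, h2⟩ := gdet_ker_le_and_gdet_saturationIn_le (E.d k) A hA
  have hBZ : E.boundaries k ≤ E.cycles k := by
    rw [hZ]
    rintro _ ⟨w, rfl⟩
    rw [LinearMap.mem_ker, mulVecLin_apply, mulVecLin_apply, mulVec_mulVec, hA, zero_mulVec]
  have h3 := gdet_eq_card_torsion_sq_mul hBZ
  rw [← hZ] at h1 h2
  change gdet (E.cycles k) ≤ gdet (saturationIn (E.boundaries k) (E.cycles k))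
    * gdet (E.harmonic k) at h1
  change gdet (saturationIn (E.boundaries k) (E.cycles k)) ≤ gdet (E.cycles k)
    * gdet (E.harmonic k) at h2
  have pS := gdet_pos (saturationIn (E.boundaries k) (E.cycles k))
  have pZ := gdet_pos (E.cycles k)
  have pH := gdet_pos (E.harmonic k)
  have pB := gdet_pos (E.boundaries k)
  set t := Nat.card (Submodule.torsion ℤ (E.Homology k)) with ht
  -- `Nat.card` of an infinite type is zero; this would force the covolume of the boundaries to
  -- vanish.
  have ht0 : 0 < t := by
    rcases Nat.eq_zero_or_pos t with h | h
    · change gdet (E.boundaries k) = (t : ℤ) ^ 2 * _ at h3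
      rw [h] at h3
      simp at h3
      omega
    · exact h
  refine ⟨ht0, ?_⟩
  set S := saturationIn (E.boundaries k) (E.cycles k)
  have l3 : Real.log (gdet (E.boundaries k)) = 2 * Real.log t + Real.log (gdet S) := by
    rw [h3]
    push_cast
    rw [Real.log_mul (by positivity) (by exact_mod_cast pS.ne'), Real.log_pow]
    norm_num
  have l1 : Real.log (gdet (E.cycles k)) ≤ Real.log (gdet S) + Real.log (gdet (E.harmonic k)) := by
    rw [← Real.log_mul (by exact_mod_cast pS.ne') (by exact_mod_cast pH.ne')]
    exact Real.log_le_log (by exact_mod_cast pZ) (by exact_mod_cast h1)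
  have l2 : Real.log (gdet S) ≤ Real.log (gdet (E.cycles k)) + Real.log (gdet (E.harmonic k)) := by
    rw [← Real.log_mul (by exact_mod_cast pZ.ne') (by exact_mod_cast pH.ne')]
    exact Real.log_le_log (by exact_mod_cast pS) (by exact_mod_cast h2)
  rw [l3, abs_le]
  constructor <;> linarith

theorem log_geomDet_complexBoundary (k : ℕ) :
    Real.log (geomDet (E.complexBoundary k))
      = (Real.log (gdet (E.cycles (k + 1))) + Real.log (gdet (E.boundaries k))) / 2 := by
  have h := geomDet_sq_eq_gdet_mul_gdet (E.d k)
  change geomDet (E.complexBoundary k) ^ 2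
    = gdet (E.cycles (k + 1)) * gdet (E.boundaries k) at h
  rw [← Real.log_mul (by exact_mod_cast (gdet_pos _).ne') (by exact_mod_cast (gdet_pos _).ne'),
    ← h, Real.log_pow]
  push_cast
  ring

/-- Each `log det'(∂_{k+1})` has a half share from the cycles in degree `k + 1` and one from the
boundaries in degree `k`. Regrouped by degree, the alternating sum consists of the quantities
bounded in `abs_log_card_torsion_le`. -/
theorem abs_log_homologyTorsion_sub_log_raySingerTorsion_le :
    |Real.log E.homologyTorsion - Real.log E.raySingerTorsion|
      ≤ (∑ k ∈ Finset.range (E.length + 1), Real.log (gdet (E.harmonic k))) / 2 := by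
  set T : ℕ → ℝ := fun k => Real.log (Nat.card (Submodule.torsion ℤ (E.Homology k)))
  set z : ℕ → ℝ := fun k => Real.log (gdet (E.cycles k))
  set b : ℕ → ℝ := fun k => Real.log (gdet (E.boundaries k))
  have hH : Real.log E.homologyTorsion = -∑ k ∈ Finset.range (E.length + 1), (-1) ^ k * T k := by
    rw [homologyTorsion, Real.log_inv, Real.log_prod]
    · congr 1
      refine Finset.sum_congr rfl fun k _ => ?_
      rw [Real.log_zpow]
      push_cast
      rfl
    · intro k _
      exact zpow_ne_zero _ (by exact_mod_cast (E.abs_log_card_torsion_le k).1.ne')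
  have hR : Real.log E.raySingerTorsion
      = ∑ k ∈ Finset.range E.length, (-1) ^ (k + 1) * ((z (k + 1) + b k) / 2) := by
    rw [raySingerTorsion, Real.log_prod]
    · refine Finset.sum_congr rfl fun k _ => ?_
      rw [Real.log_zpow, log_geomDet_complexBoundary]
      push_cast
      rfl
    · intro k _
      exact zpow_ne_zero _ (geomDet_pos _).ne'
  -- The two ends of the regrouping contribute nothing: all of `C_0` is cycles, and there are no
  -- boundaries in top degree.
  have hz : z 0 = 0 := by
    change Real.log (gdet (⊤ : Submodule ℤ (E.ι 0 → ℤ))) = 0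
    rw [gdet_top]
    simp
  have hb : b E.length = 0 := by
    have : E.boundaries E.length = ⊥ := by
      have := E.isEmpty_of_lt (E.length + 1) (Nat.lt_succ_self _)
      rw [boundaries, LinearMap.range_eq_bot]
      ext x
      exact isEmptyElim x
    change Real.log (gdet (E.boundaries E.length)) = 0
    rw [this, gdet_bot]
    simp
  have key : Real.log E.homologyTorsion - Real.log E.raySingerTorsion
      = (∑ k ∈ Finset.range (E.length + 1), (-1) ^ k * (b k - z k - 2 * T k)) / 2 := by
    have e1 : ∑ k ∈ Finset.range (E.length + 1), (-1) ^ k * b k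
        = ∑ k ∈ Finset.range E.length, (-1) ^ k * b k := by
      rw [Finset.sum_range_succ, hb, mul_zero, add_zero]
    have e2 : ∑ k ∈ Finset.range (E.length + 1), (-1) ^ k * z k
        = ∑ k ∈ Finset.range E.length, (-1) ^ (k + 1) * z (k + 1) := by
      rw [Finset.sum_range_succ', hz, mul_zero, add_zero]
    have e3 : ∑ k ∈ Finset.range (E.length + 1), (-1) ^ k * (b k - z k - 2 * T k)
        = ∑ k ∈ Finset.range (E.length + 1), (-1) ^ k * b k
          - ∑ k ∈ Finset.range (E.length + 1), (-1) ^ k * z k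
          - 2 * ∑ k ∈ Finset.range (E.length + 1), (-1) ^ k * T k := by
      rw [Finset.mul_sum, ← Finset.sum_sub_distrib, ← Finset.sum_sub_distrib]
      exact Finset.sum_congr rfl fun k _ => by ring
    have e4 : ∑ k ∈ Finset.range E.length, (-1) ^ (k + 1) * ((z (k + 1) + b k) / 2)
        = (∑ k ∈ Finset.range E.length, (-1) ^ (k + 1) * z (k + 1)
          - ∑ k ∈ Finset.range E.length, (-1) ^ k * b k) / 2 := by
      rw [← Finset.sum_sub_distrib, Finset.sum_div]
      exact Finset.sum_congr rfl fun k _ => by ring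
    rw [hH, hR, e3, e1, e2, e4]
    ring
  rw [key, abs_div, abs_of_pos (two_pos : (0 : ℝ) < 2)]
  gcongr
  refine (Finset.abs_sum_le_sum_abs _ _).trans (Finset.sum_le_sum fun k _ => ?_)
  rw [abs_mul, abs_pow, abs_neg, abs_one, one_pow, one_mul]
  exact (E.abs_log_card_torsion_le k).2

end BasedComplex
end TorsionGrowth
end

noncomputable section

namespace TorsionGrowth

/-! ### Vanishing sums of roots of unity -/

section RootsOfUnity

/-- Dividing repeatedly by the gcd with `m` separates the part of `d` supported on primes of `m`
from the part prime to `m`. -/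
theorem exists_mul_eq_coprime_of_prime_dvd (m d : ℕ) (hd : d ≠ 0) :
    ∃ d₁ d₂ : ℕ, d = d₁ * d₂ ∧ (∀ p, p.Prime → p ∣ d₁ → p ∣ m) ∧ Nat.Coprime d₂ m := by
  induction d using Nat.strong_induction_on with
  | _ d ih =>
    by_cases hg : Nat.Coprime d m
    · exact ⟨1, d, (one_mul d).symm, fun p hp h => absurd (Nat.dvd_one.mp h) hp.ne_one, hg⟩
    obtain ⟨d', hd'⟩ := Nat.gcd_dvd_left d m
    have hd0 : d' ≠ 0 := by
      rintro rfl
      exact hd (by simpa using hd')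
    have hlt : d' < d := by
      have h1 : 1 < d.gcd m :=
        lt_of_le_of_ne (Nat.gcd_pos_of_pos_left m (Nat.pos_of_ne_zero hd)) (Ne.symm hg)
      calc d' < d.gcd m * d' := by nlinarith [Nat.pos_of_ne_zero hd0]
        _ = d := hd'.symm
    obtain ⟨d₁, d₂, h1, h2, h3⟩ := ih d' hlt hd0
    refine ⟨d.gcd m * d₁, d₂, by rw [mul_assoc, ← h1, ← hd'], fun p hp h => ?_, h3⟩
    rcases (Nat.Prime.dvd_mul hp).mp h with h | h
    · exact h.trans (Nat.gcd_dvd_right d m)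
    · exact h2 p hp h

/-- Take `u ≡ k!` modulo the part of `d` supported on primes of `k!`, and `u ≡ 1` modulo the rest.
Then `1 + j u` is `1` modulo each prime of the first part and `1 + j ≤ k` modulo the second. The
exponents `1 + j u` give Galois conjugations in arithmetic progression, as a Vandermonde argument
requires. -/
theorem exists_forall_coprime_one_add_mul (k d : ℕ) (hd : d ≠ 0) :
    ∃ u : ℕ, (∀ j < k, Nat.Coprime (1 + j * u) d) ∧ Nat.gcd u d ∣ k.factorial := by
  obtain ⟨d₁, d₂, rfl, h1, h2⟩ := exists_mul_eq_coprime_of_prime_dvd k.factorial d hd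
  have hcop : Nat.Coprime d₁ d₂ := Nat.coprime_of_dvd fun p hp hp1 hp2 =>
    hp.one_lt.ne' (Nat.dvd_one.mp (h2 ▸ Nat.dvd_gcd hp2 (h1 p hp hp1)))
  obtain ⟨u, hu1, hu2⟩ := Nat.chineseRemainder hcop k.factorial 1
  refine ⟨u, fun j hj => ?_, ?_⟩
  · rw [Nat.coprime_mul_iff_right]
    constructor
    · refine Nat.coprime_of_dvd fun p hp hpa hpd => ?_
      have h3 : p ∣ u := (hu1.dvd_iff hpd).mpr (h1 p hp hpd)
      exact hp.one_lt.ne' (Nat.dvd_one.mp ((Nat.dvd_add_left (h3.mul_left j)).mp hpa))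
    · have h4 : (1 + j * u).gcd d₂ = (1 + j).gcd d₂ := by
        have : 1 + j * u ≡ 1 + j * 1 [MOD d₂] := (hu2.mul_left j).add_left 1
        simpa using this.gcd_eq
      rw [Nat.Coprime, h4]
      refine Nat.Coprime.coprime_dvd_left ?_ h2.symm
      exact Nat.dvd_factorial (by omega) (by omega)
  · have h5 : d₂.gcd u = 1 := by simpa [Nat.gcd_comm] using hu2.gcd_eq
    have h6 : u.gcd (d₁ * d₂) = u.gcd d₁ := Nat.Coprime.gcd_mul_right_cancel_right _ h5
    rw [h6, hu1.gcd_eq]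
    exact Nat.gcd_dvd_left _ _

variable {F : Type*} [Field F] [CharZero F]

/-- This is Galois conjugation: `ξ` and `ξ ^ t` have the same minimal polynomial over `ℤ`. -/
theorem sum_mul_pow_eq_zero_of_coprime {ι : Type*} (s : Finset ι) {d : ℕ} (hd : 0 < d) {ξ : F}
    (hξ : IsPrimitiveRoot ξ d) (a : ι → ℤ) (e : ι → ℕ) (h : ∑ i ∈ s, (a i : F) * ξ ^ e i = 0)
    {t : ℕ} (ht : Nat.Coprime t d) : ∑ i ∈ s, (a i : F) * (ξ ^ e i) ^ t = 0 := by
  let g : Polynomial ℤ := ∑ i ∈ s, Polynomial.C (a i) * Polynomial.X ^ e i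
  have hg : ∀ x : F, Polynomial.aeval x g = ∑ i ∈ s, (a i : F) * x ^ e i := fun x => by
    simp [g]
  have h1 : minpoly ℤ ξ ∣ g :=
    minpoly.isIntegrallyClosed_dvd (hξ.isIntegral hd) ((hg ξ).trans h)
  rw [IsPrimitiveRoot.minpoly_eq_pow_coprime hξ ht] at h1
  have h2 : Polynomial.aeval (ξ ^ t) g = 0 := by
    obtain ⟨q, hq⟩ := h1
    rw [hq, map_mul, minpoly.aeval, zero_mul]
  rw [hg] at h2
  rw [← h2]
  exact Finset.sum_congr rfl fun i _ => by rw [← pow_mul, ← pow_mul, mul_comm (e i)]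

/-- In a vanishing sum of `k` roots of unity with nonzero integral coefficients, there are two
terms whose quotient has order dividing `k!`. -/
theorem exists_pow_factorial_eq {k : ℕ} (hk : 0 < k) (U : Subgroup Fˣ) [Finite U] (a : Fin k → ℤ)
    (ha : ∀ i, a i ≠ 0) (ζ : Fin k → Fˣ) (hζ : ∀ i, ζ i ∈ U) (h : ∑ i, (a i : F) * ζ i = 0) :
    ∃ i j, i ≠ j ∧ ζ i ^ k.factorial = ζ j ^ k.factorial := by
  obtain ⟨g, hg⟩ := IsCyclic.exists_generator (α := U)
  have hg0 : 0 < orderOf g := orderOf_pos g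
  have hprim : IsPrimitiveRoot ((g : Fˣ) : F) (orderOf g) := by
    rw [IsPrimitiveRoot.coe_units_iff, ← Subgroup.orderOf_coe]
    exact IsPrimitiveRoot.orderOf _
  have hpow : ∀ i, ∃ e : ℕ, (g : Fˣ) ^ e = ζ i := fun i => by
    obtain ⟨e, he⟩ := mem_powers_iff_mem_zpowers.mpr (hg ⟨ζ i, hζ i⟩)
    exact ⟨e, congrArg Subtype.val he⟩
  choose e he using hpow
  obtain ⟨u, hu1, hu2⟩ := exists_forall_coprime_one_add_mul k (orderOf g) hg0.ne'
  -- Conjugating by the exponents `1 + j u` gives a Vandermonde system with nodes `ζ i ^ u` and a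
  -- nonzero solution, so two nodes coincide.
  have hsum : ∀ j : Fin k, ∑ i, (a i * ζ i : F) * ((ζ i : F) ^ u) ^ (j : ℕ) = 0 := fun j => by
    have h0 : ∑ i, (a i : F) * ((g : Fˣ) : F) ^ e i = 0 := by
      rw [← h]
      refine Finset.sum_congr rfl fun i _ => ?_
      rw [← he i, Units.val_pow_eq_pow_val]
    rw [← sum_mul_pow_eq_zero_of_coprime Finset.univ hg0 hprim a e h0 (hu1 j j.2)]
    refine Finset.sum_congr rfl fun i _ => ?_
    rw [← he i, Units.val_pow_eq_pow_val]
    ring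
  have hninj : ¬ Function.Injective fun i => (ζ i : F) ^ u := fun hinj => by
    have h1 := Matrix.eq_zero_of_forall_pow_sum_mul_pow_eq_zero hinj hsum
    have h2 := congrFun h1 ⟨0, hk⟩
    exact mul_ne_zero (by exact_mod_cast ha _) (ζ _).ne_zero h2
  simp only [Function.Injective, not_forall] at hninj
  obtain ⟨i, j, hij, hne⟩ := hninj
  refine ⟨i, j, hne, ?_⟩
  -- The order of the quotient divides both `u` and the order of `g`, hence their gcd, which divides
  -- `k!`.
  have h1 : (ζ i / ζ j) ^ u = 1 := by
    rw [div_pow, div_eq_one]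
    exact Units.ext (by simpa using hij)
  have h2 : (ζ i / ζ j) ^ orderOf g = 1 := by
    have h3 : (g : Fˣ) ^ orderOf g = 1 := by exact_mod_cast pow_orderOf_eq_one g
    rw [← he i, ← he j, div_pow, ← pow_mul, ← pow_mul, mul_comm (e i), mul_comm (e j), pow_mul,
      pow_mul, h3, one_pow, one_pow, div_one]
  rw [← div_eq_one, ← div_pow]
  obtain ⟨c, hc⟩ := hu2
  rw [hc, pow_mul, pow_gcd_eq_one.mpr ⟨h1, h2⟩, one_pow]

end RootsOfUnity
end TorsionGrowth
end

noncomputable section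

namespace TorsionGrowth

open AddMonoidAlgebra

/-! ### Zeros of an element of a group ring at characters of finite order -/

section Annihilate

variable {G A : Type*} [AddCommGroup G] [AddCommGroup A] [Fintype A]

open Classical in
/-- The sum of the elements of the cyclic subgroup generated by `a`. -/
def orbitSum (a : A) : AddMonoidAlgebra ℤ A :=
  ∑ x : A with x ∈ AddSubgroup.zmultiples a, single x 1

open Classical in
/-- The nonzero multiples `k! • (m - m')`, where `m` and `m'` run through the support of `f` and
`k` is the cardinality of the support. -/
def specialDirections (f : AddMonoidAlgebra ℤ G) : Finset G :=
  f.coeff.support.offDiag.image fun q => f.coeff.support.card.factorial • (q.1 - q.2)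

theorem ne_zero_of_mem_specialDirections [IsAddTorsionFree G] {f : AddMonoidAlgebra ℤ G} {m : G}
    (hm : m ∈ specialDirections f) : m ≠ 0 := by
  classical
  simp only [specialDirections, Finset.mem_image, Finset.mem_offDiag] at hm
  obtain ⟨q, ⟨-, -, hq⟩, rfl⟩ := hm
  exact smul_ne_zero (Nat.factorial_ne_zero _) (sub_ne_zero.mpr hq)

/-- On `A`, `ψ` is a character whose values are roots of unity, so the hypothesis is a vanishing sum
of them. Its terms are indexed by the support of `f` in `G`, not of its image, so the coefficients
stay nonzero and the directions do not depend on `A`. -/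
theorem exists_mem_specialDirections_of_map_eq_zero {F : Type*} [Field F] [CharZero F]
    {f : AddMonoidAlgebra ℤ G} (hf : f ≠ 0) (φ : G →+ A) (ψ : AddMonoidAlgebra ℤ A →+* F)
    (h : ψ (mapDomainRingHom ℤ φ f) = 0) :
    ∃ m ∈ specialDirections f, ψ (single (φ m) 1) = 1 := by
  classical
  let χ : Multiplicative A →* Fˣ :=
    ((ψ : AddMonoidAlgebra ℤ A →* F).comp (AddMonoidAlgebra.of ℤ A)).toHomUnits
  have hχ : ∀ a, ((χ (Multiplicative.ofAdd a) : Fˣ) : F) = ψ (single a 1) := fun a => rfl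
  have : Finite χ.range := Set.finite_range χ
  set s := f.coeff.support with hs
  have hk : 0 < s.card := by
    rw [Finset.card_pos, hs, Finsupp.support_nonempty_iff]
    intro h0
    exact hf (AddMonoidAlgebra.ext (by simpa using h0))
  let e := s.equivFin.symm
  have hsum : ∑ i, ((f.coeff (e i) : ℤ) : F) * χ (Multiplicative.ofAdd (φ (e i))) = 0 := by
    rw [← h]
    have h1 : f = ∑ m ∈ s, single m (f.coeff m) := by
      conv_lhs => rw [← sum_coeff_single f]
      rfl
    conv_rhs => rw [h1]
    rw [map_sum, map_sum, ← Finset.sum_coe_sort s]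
    refine Fintype.sum_equiv e _ _ fun i => ?_
    rw [hχ, mapDomainRingHom_apply, mapDomain_single]
    have h2 : (single (φ (e i)) (f.coeff (e i)) : AddMonoidAlgebra ℤ A)
        = f.coeff (e i) • single (φ (e i)) 1 := by
      simp
    rw [h2, map_zsmul, zsmul_eq_mul]
  obtain ⟨i, j, hij, h2⟩ := exists_pow_factorial_eq hk χ.range (fun i => f.coeff (e i))
    (fun i => Finsupp.mem_support_iff.mp (e i).2) (fun i => χ (Multiplicative.ofAdd (φ (e i))))
    (fun i => ⟨_, rfl⟩) hsum
  refine ⟨s.card.factorial • ((e i : G) - e j), ?_, ?_⟩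
  · refine Finset.mem_image.mpr ⟨(e i, e j), Finset.mem_offDiag.mpr ⟨(e i).2, (e j).2, ?_⟩, rfl⟩
    exact fun h => hij (e.injective (Subtype.ext h))
  · rw [← hχ, map_nsmul, map_sub, ofAdd_nsmul, ofAdd_sub, map_pow, map_div, div_pow, h2, div_self',
      Units.val_one]

theorem map_orbitSum {F : Type*} [Field F] (ψ : AddMonoidAlgebra ℤ A →+* F) {a : A}
    (ha : ψ (single a 1) = 1) : ψ (orbitSum a) = (Nat.card (AddSubgroup.zmultiples a) : F) := by
  classical
  have h1 : ∀ x ∈ AddSubgroup.zmultiples a, ψ (single x 1) = 1 := by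
    intro x hx
    obtain ⟨n, rfl⟩ := mem_multiples_iff_mem_zmultiples.mpr hx
    change ψ (single (n • a) 1) = 1
    have : (single (n • a) 1 : AddMonoidAlgebra ℤ A) = single a 1 ^ n := by
      rw [single_pow, one_pow]
    rw [this, map_pow, ha, one_pow]
  rw [orbitSum, map_sum, Finset.sum_congr rfl fun x hx => h1 x (Finset.mem_filter.mp hx).2,
    Finset.sum_const, nsmul_eq_mul, mul_one, Nat.card_eq_fintype_card, Fintype.card_subtype]

/-- The ideal generated by the image of `f ≠ 0` and the orbit sums of its special directions
contains a nonzero integer. -/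
theorem exists_intCast_eq_mul_add_sum {f : AddMonoidAlgebra ℤ G} (hf : f ≠ 0)
    (φ : G →+ A) :
    ∃ (c : ℤ) (g : AddMonoidAlgebra ℤ A) (q : specialDirections f → AddMonoidAlgebra ℤ A), c ≠ 0 ∧
      (c : AddMonoidAlgebra ℤ A) = g * mapDomainRingHom ℤ φ f
        + ∑ m, q m * orbitSum (φ m) := by
  classical
  let I : Ideal (AddMonoidAlgebra ℤ A) := Ideal.span {mapDomainRingHom ℤ φ f}
    ⊔ Ideal.span ((fun m => orbitSum (φ m)) '' (specialDirections f : Set G))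
  let S : Submonoid (AddMonoidAlgebra ℤ A) :=
    (nonZeroDivisors ℤ).map (Int.castRingHom (AddMonoidAlgebra ℤ A))
  -- Otherwise some prime `P ⊇ I` avoids the nonzero integers, and the fraction field of the
  -- quotient has characteristic zero. There `f` vanishes, so some direction becomes trivial and its
  -- orbit sum becomes a positive integer, although it lies in `P`.
  by_cases hI : Disjoint (I : Set (AddMonoidAlgebra ℤ A)) S
  · exfalso
    obtain ⟨P, hP, hIP, hPS⟩ := Ideal.exists_le_prime_disjoint I S hI
    let F := FractionRing (AddMonoidAlgebra ℤ A ⧸ P)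
    let ψ : AddMonoidAlgebra ℤ A →+* F := (algebraMap _ F).comp (Ideal.Quotient.mk P)
    have hψ : ∀ x, ψ x = 0 ↔ x ∈ P := fun x => by
      rw [RingHom.comp_apply, FaithfulSMul.algebraMap_eq_zero_iff, Ideal.Quotient.eq_zero_iff_mem]
    have : CharZero F := by
      refine charZero_of_inj_zero fun n hn => ?_
      by_contra hn0
      refine Set.disjoint_left.mp hPS ((hψ (n : AddMonoidAlgebra ℤ A)).mp ?_)
        ⟨n, mem_nonZeroDivisors_of_ne_zero (by exact_mod_cast hn0), by simp⟩
      rw [map_natCast, hn]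
    have h0 : ψ (mapDomainRingHom ℤ φ f) = 0 :=
      (hψ _).mpr (hIP (Ideal.mem_sup_left (Ideal.subset_span rfl)))
    obtain ⟨m, hm, hm1⟩ := exists_mem_specialDirections_of_map_eq_zero hf φ ψ h0
    have h1 : ψ (orbitSum (φ m)) = 0 :=
      (hψ _).mpr (hIP (Ideal.mem_sup_right (Ideal.subset_span ⟨m, hm, rfl⟩)))
    rw [map_orbitSum ψ hm1] at h1
    exact Nat.card_pos.ne' (by exact_mod_cast h1)
  · obtain ⟨x, hxI, c, hc, rfl⟩ := Set.not_disjoint_iff.mp hI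
    obtain ⟨y, hy, z, hz, hyz⟩ := Submodule.mem_sup.mp hxI
    obtain ⟨g, rfl⟩ := Ideal.mem_span_singleton'.mp hy
    obtain ⟨q, rfl⟩ := (Submodule.mem_span_image_finset_iff_exists_fun _).mp hz
    exact ⟨c, g, q, nonZeroDivisors.ne_zero hc, by simpa using hyz.symm⟩

end Annihilate
end TorsionGrowth
end

noncomputable section

namespace TorsionGrowth

open Matrix Module AddMonoidAlgebra

/-! ### Integral matrices of matrices over a group ring -/

section RegularMatrix

open BasedComplex

variable {A A' : Type*} [AddCommGroup A] [Fintype A] [AddCommGroup A'] [Fintype A']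
variable {ι κ : Type*}

theorem regularMatrix_add (M N : Matrix ι κ (AddMonoidAlgebra ℤ A)) :
    regularMatrix (M + N) = regularMatrix M + regularMatrix N := by
  ext x y
  simp [regularMatrix]

theorem regularMatrix_zero : regularMatrix (0 : Matrix ι κ (AddMonoidAlgebra ℤ A)) = 0 := by
  ext x y
  simp [regularMatrix]

theorem regularMatrix_sum {τ : Type*} (s : Finset τ) (M : τ → Matrix ι κ (AddMonoidAlgebra ℤ A)) :
    regularMatrix (∑ t ∈ s, M t) = ∑ t ∈ s, regularMatrix (M t) := by
  classical
  induction s using Finset.induction_on with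
  | empty => simpa using regularMatrix_zero
  | insert t s ht ih => rw [Finset.sum_insert ht, Finset.sum_insert ht, regularMatrix_add, ih]

theorem regularMatrix_smul_one_intCast [DecidableEq ι] [DecidableEq A] (c : ℤ) :
    regularMatrix ((c : AddMonoidAlgebra ℤ A) • (1 : Matrix ι ι (AddMonoidAlgebra ℤ A)))
      = c • 1 := by
  have hc : ∀ x, (c : AddMonoidAlgebra ℤ A).coeff x = if x = 0 then c else 0 := fun x => by
    rw [← zsmul_one, one_def]
    simp [Finsupp.single_apply, eq_comm]
  ext ⟨i, a⟩ ⟨j, b⟩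
  by_cases h : i = j
  · subst h
    simp [regularMatrix, hc, sub_eq_zero, Matrix.one_apply]
  · simp [regularMatrix, h]

/-- The matrix of the map `ℤ^(ι × A') → ℤ^(ι × A)` of composition with `π : A → A'`. -/
def pullbackMatrix (ι : Type*) [DecidableEq ι] [DecidableEq A'] (π : A →+ A') :
    Matrix (ι × A) (ι × A') ℤ :=
  Matrix.of fun x y => if x.1 = y.1 ∧ π x.2 = y.2 then 1 else 0

theorem coeff_mapDomain_apply [DecidableEq A'] (π : A →+ A') (f : AddMonoidAlgebra ℤ A) (b : A') :
    (mapDomainRingHom ℤ π f).coeff b = ∑ a : A with π a = b, f.coeff a := by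
  classical
  rw [mapDomainRingHom_apply, coeff_mapDomain, Finsupp.mapDomain, Finsupp.sum_fintype _ _ (by simp),
    Finsupp.finsetSum_apply, Finset.sum_filter]
  simp [Finsupp.single_apply]

variable [DecidableEq A']

/-- Pullback along `π` intertwines convolution by `M` with convolution by its image, because a
coefficient of the image is a sum over a fibre of `π`. -/
theorem regularMatrix_mul_pullbackMatrix [Fintype κ] [DecidableEq ι] [DecidableEq κ] (π : A →+ A')
    (M : Matrix ι κ (AddMonoidAlgebra ℤ A)) [Fintype ι] :
    regularMatrix M * pullbackMatrix κ π
      = pullbackMatrix ι π * regularMatrix (M.map (mapDomainRingHom ℤ π)) := by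
  ext ⟨i, a⟩ ⟨j, b⟩
  have h1 : (regularMatrix M * pullbackMatrix κ π) (i, a) (j, b)
      = ∑ x : A with π x = b, (M i j).coeff (a - x) := by
    rw [Matrix.mul_apply, Fintype.sum_prod_type, Finset.sum_eq_single j]
    · simp [regularMatrix, pullbackMatrix, Finset.sum_filter]
    · intro k _ hk
      simp [pullbackMatrix, hk]
    · simp
  have h2 : (pullbackMatrix ι π * regularMatrix (M.map (mapDomainRingHom ℤ π))) (i, a) (j, b)
      = (mapDomainRingHom ℤ π (M i j)).coeff (π a - b) := by
    rw [Matrix.mul_apply, Finset.sum_eq_single (i, π a)]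
    · simp [regularMatrix, pullbackMatrix]
    · rintro ⟨k, c⟩ _ hk
      rw [pullbackMatrix, Matrix.of_apply, if_neg, zero_mul]
      rintro ⟨rfl, rfl⟩
      exact hk rfl
    · simp
  rw [h1, h2, coeff_mapDomain_apply]
  refine Finset.sum_nbij' (fun x => a - x) (fun x => a - x) ?_ ?_ ?_ ?_ ?_
  · intro x hx
    simp only [Finset.mem_filter, Finset.mem_univ, true_and] at hx ⊢
    rw [map_sub, hx]
  · intro x hx
    simp only [Finset.mem_filter, Finset.mem_univ, true_and] at hx ⊢
    rw [map_sub, hx, sub_sub_cancel]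
  · intro x _
    exact sub_sub_cancel a x
  · intro x _
    exact sub_sub_cancel a x
  · intro x _
    rfl

theorem pullbackMatrix_mulVec_apply [Fintype ι] [DecidableEq ι] (π : A →+ A') (v : ι × A' → ℤ) (x : ι × A) :
    (pullbackMatrix ι π *ᵥ v) x = v (x.1, π x.2) := by
  rw [mulVec, dotProduct, Finset.sum_eq_single (x.1, π x.2)]
  · simp [pullbackMatrix]
  · rintro ⟨k, c⟩ _ hk
    rw [pullbackMatrix, Matrix.of_apply, if_neg, zero_mul]
    rintro ⟨h1, h2⟩
    exact hk (Prod.ext h1.symm h2.symm)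
  · simp

/-- All fibres have `|ker π|` elements, so pullback multiplies squared lengths by that number. -/
theorem transpose_pullbackMatrix_mul_self [Fintype ι] [DecidableEq ι] {π : A →+ A'}
    (hπ : Function.Surjective π) :
    (pullbackMatrix ι π)ᵀ * pullbackMatrix ι π = (Nat.card π.ker : ℤ) • 1 := by
  classical
  have hfib : ∀ b, (Finset.univ.filter fun a => π a = b).card = Nat.card π.ker := by
    intro b
    obtain ⟨a₀, rfl⟩ := hπ b
    rw [Nat.card_eq_fintype_card, ← Fintype.card_subtype]
    refine Fintype.card_congr ((Equiv.subRight a₀).subtypeEquiv fun a => ?_)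
    rw [Equiv.subRight_apply, AddMonoidHom.mem_ker, map_sub, sub_eq_zero]
  ext ⟨i, b⟩ ⟨j, c⟩
  rw [Matrix.mul_apply, Fintype.sum_prod_type, Finset.sum_eq_single i]
  · by_cases hij : i = j
    · subst hij
      by_cases hbc : b = c
      · subst hbc
        have h1 : ∑ a, (if π a = b then (if π a = b then (1 : ℤ) else 0) else 0)
            = (Nat.card π.ker : ℤ) := by
          rw [← hfib b, Finset.card_filter]
          push_cast
          exact Finset.sum_congr rfl fun a _ => by split_ifs <;> rfl
        simpa [pullbackMatrix] using h1
      · simp [pullbackMatrix, hbc]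
        refine Finset.sum_eq_zero fun x _ => ?_
        by_cases h1 : π x = c
        · rw [if_pos h1, if_neg fun h2 => hbc (h2.symm.trans h1)]
        · rw [if_neg h1]
    · simp [pullbackMatrix, hij]
  · intro k _ hk
    simp [pullbackMatrix, hk]
  · simp

/-- Convolution by the orbit sum adds up over cosets of `⟨a⟩`, which are the nonempty fibres of `π`;
so it factors through functions on `A'`. -/
theorem regularMatrix_orbitSum [Fintype ι] [DecidableEq ι] (a : A) {π : A →+ A'}
    (hπ : π.ker = AddSubgroup.zmultiples a) :
    regularMatrix (orbitSum a • (1 : Matrix ι ι (AddMonoidAlgebra ℤ A)))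
      = pullbackMatrix ι π * (pullbackMatrix ι π)ᵀ := by
  classical
  have h0 : ∀ x, (orbitSum a).coeff x = if x ∈ AddSubgroup.zmultiples a then 1 else 0 := by
    intro x
    simp [orbitSum, coeff_sum, Finsupp.finsetSum_apply, coeff_single, Finsupp.single_apply]
  ext ⟨i, b⟩ ⟨j, c⟩
  rw [Matrix.mul_apply, Finset.sum_eq_single (i, π b)]
  · rw [transpose_apply, pullbackMatrix, Matrix.of_apply, Matrix.of_apply, if_pos ⟨rfl, rfl⟩, one_mul]
    by_cases h : i = j
    · subst h
      simp only [regularMatrix, Matrix.of_apply, Matrix.smul_apply, Matrix.one_apply_eq, smul_eq_mul,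
        mul_one, h0, ← hπ, AddMonoidHom.mem_ker, map_sub, sub_eq_zero, true_and]
      simp only [eq_comm]
    · simp [regularMatrix, h, Ne.symm h]
  · rintro ⟨k, d⟩ _ hk
    rw [pullbackMatrix, Matrix.of_apply, if_neg, zero_mul]
    rintro ⟨rfl, rfl⟩
    exact hk rfl
  · simp

end RegularMatrix
end TorsionGrowth
end

noncomputable section

namespace TorsionGrowth

open Matrix Module AddMonoidAlgebra BasedComplex

/-! ### The covolume of the kernel of a matrix over the group ring of a finite group -/

section KernelBound

variable {A ι τ : Type*} [AddCommGroup A] [Fintype A] [Fintype ι] [DecidableEq ι]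
  [Fintype τ] [DecidableEq τ] {A' : τ → Type*} [∀ t, AddCommGroup (A' t)] [∀ t, Fintype (A' t)]
  [∀ t, DecidableEq (A' t)]

theorem sigma_mulVec {R X : Type*} [CommRing R] {n : τ → Type*} [∀ t, Fintype (n t)]
    (M : ∀ t, Matrix X (n t) R) (x : (Σ t, n t) → R) :
    (Matrix.of fun i (s : Σ t, n t) => M s.1 i s.2) *ᵥ x = ∑ t, M t *ᵥ fun j => x ⟨t, j⟩ := by
  ext i
  rw [Finset.sum_apply, mulVec, dotProduct, Fintype.sum_sigma]
  rfl

theorem dotProduct_blockDiagonal'_mulVec {R : Type*} [CommRing R] {n : τ → Type*}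
    [∀ t, Fintype (n t)] (M : ∀ t, Matrix (n t) (n t) R) (x : (Σ t, n t) → R) :
    x ⬝ᵥ blockDiagonal' M *ᵥ x
      = ∑ t, (fun j => x ⟨t, j⟩) ⬝ᵥ M t *ᵥ (fun j => x ⟨t, j⟩) := by
  have h1 : ∀ t (j : n t), (blockDiagonal' M *ᵥ x) ⟨t, j⟩ = (M t *ᵥ fun j => x ⟨t, j⟩) j := by
    intro t j
    rw [mulVec, dotProduct, Fintype.sum_sigma, Finset.sum_eq_single t]
    · simp [mulVec, dotProduct]
    · intro u _ hu
      refine Finset.sum_eq_zero fun k _ => ?_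
      rw [blockDiagonal'_apply_ne _ _ _ (Ne.symm hu), zero_mul]
    · simp
  rw [dotProduct, Fintype.sum_sigma]
  refine Finset.sum_congr rfl fun t _ => ?_
  rw [dotProduct]
  exact Finset.sum_congr rfl fun j _ => by rw [h1]

theorem det_blockDiagonal'_eq_prod {R : Type*} [CommRing R] {n : τ → Type*} [∀ t, Fintype (n t)]
    [∀ t, DecidableEq (n t)] (M : ∀ t, Matrix (n t) (n t) R) :
    (blockDiagonal' M).det = ∏ t, (M t).det := by
  classical
  -- Any linear order will do; it lets the block diagonal matrix count as block triangular.
  let _ : LinearOrder τ := IsWellOrder.linearOrder WellOrderingRel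
  have h : (blockDiagonal' M).BlockTriangular Sigma.fst := fun i j hij =>
    blockDiagonal'_apply_ne M i.2 j.2 (ne_of_gt hij)
  rw [h.det_fintype]
  refine Finset.prod_congr rfl fun t _ => ?_
  rw [← det_submatrix_equiv_self (Equiv.sigmaSubtype t).symm]
  congr 1
  · ext i j
    simp [toSquareBlock, toSquareBlockProp, Equiv.sigmaSubtype]

theorem dotProduct_self_sum_le {X : Type*} [Fintype X] (v : τ → X → ℝ) :
    (∑ t, v t) ⬝ᵥ (∑ t, v t) ≤ Fintype.card τ * ∑ t, v t ⬝ᵥ v t := by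
  simp only [dotProduct]
  rw [Finset.sum_comm, Finset.mul_sum]
  refine Finset.sum_le_sum fun x _ => ?_
  rw [Finset.sum_apply, ← sq, ← Finset.card_univ]
  simpa [sq] using sq_sum_le_card_mul_sum_sq (s := Finset.univ) (f := fun t => v t x)

/-- Apply the identity for `c` to `h`. The term with `Δ.det` dies because `det Δ = adj Δ · Δ`, and
each orbit sum sends `h` to a function pulled back from `A' t`. -/
theorem exists_smul_mem_of_intCast_eq (Δ : Matrix ι ι (AddMonoidAlgebra ℤ A)) (a : τ → A)
    {π : ∀ t, A →+ A' t} (hπ : ∀ t, Function.Surjective (π t))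
    (hker : ∀ t, (π t).ker = AddSubgroup.zmultiples (a t)) {c : ℤ} {g : AddMonoidAlgebra ℤ A}
    {q : τ → AddMonoidAlgebra ℤ A}
    (hcomb : (c : AddMonoidAlgebra ℤ A) = g * Δ.det + ∑ t, q t * orbitSum (a t))
    {h : ι × A → ℤ} (hh : regularMatrix Δ *ᵥ h = 0) :
    ∃ y : ∀ t, ι × A' t → ℤ,
      (∀ t, regularMatrix (Δ.map (mapDomainRingHom ℤ (π t))) *ᵥ y t = 0) ∧
      c • h = ∑ t, pullbackMatrix ι (π t) *ᵥ y t := by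
  classical
  have h1 : (c : AddMonoidAlgebra ℤ A) • (1 : Matrix ι ι (AddMonoidAlgebra ℤ A))
      = (g • Δ.adjugate) * Δ + ∑ t, (q t • 1) * (orbitSum (a t) • 1) := by
    rw [hcomb, add_smul, Matrix.smul_mul, adjugate_mul, smul_smul, Finset.sum_smul]
    congr 1
    refine Finset.sum_congr rfl fun t _ => ?_
    rw [Matrix.smul_mul, Matrix.one_mul, smul_smul]
  have h2 := congrArg regularMatrix h1
  rw [regularMatrix_smul_one_intCast, regularMatrix_add, ← regularMatrix_mul,
    regularMatrix_sum] at h2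
  have h3 := congrArg (· *ᵥ h) h2
  simp only [smul_mulVec, one_mulVec, Matrix.add_mulVec, ← mulVec_mulVec, hh, mulVec_zero,
    zero_add, Matrix.sum_mulVec] at h3
  have hmap : ∀ t (p : AddMonoidAlgebra ℤ A),
      (p • (1 : Matrix ι ι (AddMonoidAlgebra ℤ A))).map (mapDomainRingHom ℤ (π t))
        = mapDomainRingHom ℤ (π t) p • 1 := fun t p => by
    ext i j
    by_cases hij : i = j <;> simp [hij]
  -- With `J` the pullback, `J Δ' Jᵀ h = Δ J Jᵀ h` is the orbit sum applied to `Δ h = 0`, and `J` is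
  -- injective as `π t` is surjective.
  have h4 : ∀ t, regularMatrix (Δ.map (mapDomainRingHom ℤ (π t)))
      *ᵥ ((pullbackMatrix ι (π t))ᵀ *ᵥ h) = 0 := by
    intro t
    have h5 : pullbackMatrix ι (π t) *ᵥ (regularMatrix (Δ.map (mapDomainRingHom ℤ (π t)))
        *ᵥ ((pullbackMatrix ι (π t))ᵀ *ᵥ h)) = 0 := by
      rw [mulVec_mulVec, ← regularMatrix_mul_pullbackMatrix, mulVec_mulVec, Matrix.mul_assoc,
        ← regularMatrix_orbitSum (a t) (hker t), regularMatrix_mul, Matrix.mul_smul,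
        Matrix.mul_one, ← Matrix.one_mul Δ, ← Matrix.smul_mul, ← regularMatrix_mul,
        ← mulVec_mulVec, hh, mulVec_zero]
    ext ⟨i, b⟩
    obtain ⟨b, rfl⟩ := hπ t b
    have := congrFun h5 (i, b)
    rwa [pullbackMatrix_mulVec_apply] at this
  refine ⟨fun t => regularMatrix ((q t • (1 : Matrix ι ι (AddMonoidAlgebra ℤ A))).map
    (mapDomainRingHom ℤ (π t))) *ᵥ ((pullbackMatrix ι (π t))ᵀ *ᵥ h), fun t => ?_, ?_⟩
  · rw [mulVec_mulVec, regularMatrix_mul, hmap, Matrix.mul_smul, Matrix.mul_one,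
      ← Matrix.one_mul (Δ.map _), ← Matrix.smul_mul, ← regularMatrix_mul, ← mulVec_mulVec,
      h4, mulVec_zero]
  · rw [h3]
    refine Finset.sum_congr rfl fun t _ => ?_
    rw [← regularMatrix_mul, regularMatrix_orbitSum (a t) (hker t), ← Matrix.mul_assoc,
      regularMatrix_mul_pullbackMatrix]
    simp only [mulVec_mulVec, Matrix.mul_assoc]

/-- The pulled-back kernels span a sublattice of finite index, so its covolume suffices. It is the
range of `Q`, whose source carries the orthogonal sum `G` of the pulled-back Gram forms. The sum of
the kernels need not be direct, which is why `gdet_range_le` allows `Q` to have a kernel. -/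
theorem gdet_ker_regularMatrix_le (Δ : Matrix ι ι (AddMonoidAlgebra ℤ A)) (a : τ → A)
    {π : ∀ t, A →+ A' t} (hπ : ∀ t, Function.Surjective (π t))
    (hker : ∀ t, (π t).ker = AddSubgroup.zmultiples (a t)) {c : ℤ} (hc : c ≠ 0)
    {g : AddMonoidAlgebra ℤ A} {q : τ → AddMonoidAlgebra ℤ A}
    (hcomb : (c : AddMonoidAlgebra ℤ A) = g * Δ.det + ∑ t, q t * orbitSum (a t))
    {C : ℝ} (hC0 : 0 ≤ C)
    (hC : ∀ t (x : ι × A' t → ℝ),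
      ((regularMatrix (Δ.map (mapDomainRingHom ℤ (π t)))).map (Int.cast : ℤ → ℝ) *ᵥ x) ⬝ᵥ
        ((regularMatrix (Δ.map (mapDomainRingHom ℤ (π t)))).map (Int.cast : ℤ → ℝ) *ᵥ x)
        ≤ C * (x ⬝ᵥ x)) :
    (gdet (LinearMap.ker (regularMatrix Δ).mulVecLin) : ℝ) ≤ ∏ t,
      ((Fintype.card τ + 1) * Nat.card (π t).ker * (C + 1)) ^ (Fintype.card (ι × A' t)) := by
  classical
  choose r K hK using fun t =>
    exists_isBasisMatrix (LinearMap.ker (regularMatrix (Δ.map (mapDomainRingHom ℤ (π t)))).mulVecLin)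
  set J := fun t => pullbackMatrix ι (π t) with hJ
  set o : τ → ℤ := fun t => (Nat.card (π t).ker : ℤ) with ho
  have ho1 : ∀ t, 1 ≤ o t := fun t => by
    have : 1 ≤ Nat.card (π t).ker := Nat.card_pos
    exact Int.ofNat_le.mpr this
  set Q : Matrix (ι × A) (Σ t, Fin (r t)) ℤ :=
    Matrix.of fun i (s : Σ t, Fin (r t)) => (J s.1 * K s.1) i s.2 with hQ
  set G : Matrix (Σ t, Fin (r t)) (Σ t, Fin (r t)) ℤ :=
    blockDiagonal' fun t => o t • ((K t)ᵀ * K t) with hG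
  have hJJ : ∀ t, (J t * K t)ᵀ * (J t * K t) = o t • ((K t)ᵀ * K t) := fun t => by
    rw [transpose_mul, Matrix.mul_assoc, ← Matrix.mul_assoc (J t)ᵀ, hJ,
      transpose_pullbackMatrix_mul_self (hπ t), Matrix.smul_mul, Matrix.one_mul, Matrix.mul_smul]
  have hinj : ∀ t v, (J t * K t) *ᵥ v = 0 → v = 0 := fun t v hv => by
    have h1 : (o t • ((K t)ᵀ * K t)) *ᵥ v = 0 := by
      rw [← hJJ, ← mulVec_mulVec, hv, mulVec_zero]
    rw [smul_mulVec] at h1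
    exact (hK t).eq_zero v (gram_mulVec_eq_zero ((smul_eq_zero.mp h1).resolve_left
      (by have := ho1 t; omega)))
  have hGmap : G.map (Int.cast : ℤ → ℝ)
      = blockDiagonal' fun t => ((J t * K t)ᵀ * (J t * K t)).map (Int.cast : ℤ → ℝ) := by
    rw [hG, blockDiagonal'_map _ _ Int.cast_zero]
    congr 1
    ext1 t
    rw [hJJ]
  have hQmap : ∀ x, Q.map (Int.cast : ℤ → ℝ) *ᵥ x
      = ∑ t, (J t * K t).map (Int.cast : ℤ → ℝ) *ᵥ fun j => x ⟨t, j⟩ :=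
    fun x => sigma_mulVec (fun t => (J t * K t).map (Int.cast : ℤ → ℝ)) x
  have hQv : ∀ x, Q *ᵥ x = ∑ t, (J t * K t) *ᵥ fun j => x ⟨t, j⟩ :=
    fun x => sigma_mulVec (fun t => J t * K t) x
  have hGpd : (G.map (Int.cast : ℤ → ℝ)).PosDef := by
    refine PosDef.of_dotProduct_mulVec_pos ?_ fun x hx => ?_
    · rw [hGmap, IsHermitian, blockDiagonal'_conjTranspose]
      congr 1
      ext1 t
      exact (posDef_gram (hinj t)).1
    · rw [star_trivial, hGmap, dotProduct_blockDiagonal'_mulVec]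
      have hne : ∃ t, (fun j => x ⟨t, j⟩) ≠ 0 := by
        by_contra hcon
        push Not at hcon
        exact hx (funext fun ⟨t, j⟩ => congrFun (hcon t) j)
      obtain ⟨t, ht⟩ := hne
      refine Finset.sum_pos' (fun t _ => ?_) ⟨t, Finset.mem_univ t, ?_⟩
      · simpa using (posDef_gram (hinj t)).posSemidef.dotProduct_mulVec_nonneg (fun j => x ⟨t, j⟩)
      · simpa using (posDef_gram (hinj t)).dotProduct_mulVec_pos ht
  -- Cauchy-Schwarz gives the constant `card τ`; adding one keeps it at least one when `τ` is empty.
  have hτ : (1 : ℝ) ≤ Fintype.card τ + 1 := by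
    have : (0 : ℝ) ≤ Fintype.card τ := by positivity
    linarith
  have hbound := gdet_range_le hGpd Q hτ fun x => by
    rw [hQmap, hGmap, dotProduct_blockDiagonal'_mulVec]
    refine (dotProduct_self_sum_le _).trans ?_
    have e1 : ∀ t, (fun j => x ⟨t, j⟩) ⬝ᵥ
          ((J t * K t)ᵀ * (J t * K t)).map (Int.cast : ℤ → ℝ) *ᵥ (fun j => x ⟨t, j⟩)
        = ((J t * K t).map (Int.cast : ℤ → ℝ) *ᵥ fun j => x ⟨t, j⟩) ⬝ᵥ
          ((J t * K t).map (Int.cast : ℤ → ℝ) *ᵥ fun j => x ⟨t, j⟩) := fun t => by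
      rw [map_intCast_mul, transpose_map, ← mulVec_mulVec, dotProduct_mulVec, vecMul_transpose]
    simp only [e1]
    refine mul_le_mul_of_nonneg_right (by linarith) (Finset.sum_nonneg fun t _ => ?_)
    exact Finset.sum_nonneg fun i _ => mul_self_nonneg _
  have hle : LinearMap.range Q.mulVecLin ≤ LinearMap.ker (regularMatrix Δ).mulVecLin := by
    rintro _ ⟨x, rfl⟩
    rw [LinearMap.mem_ker, mulVecLin_apply, mulVecLin_apply, hQv, mulVec_sum]
    refine Finset.sum_eq_zero fun t _ => ?_
    rw [mulVec_mulVec, ← Matrix.mul_assoc, hJ, regularMatrix_mul_pullbackMatrix, Matrix.mul_assoc,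
      ← mulVec_mulVec, ← mulVec_mulVec]
    have : regularMatrix (Δ.map (mapDomainRingHom ℤ (π t))) *ᵥ (K t *ᵥ fun j => x ⟨t, j⟩) = 0 :=
      (hK t).mulVec_mem _
    rw [this, mulVec_zero]
  have hfin := gdet_le_of_forall_exists_smul_mem hle fun h hh => by
    obtain ⟨y, hy, hcy⟩ := exists_smul_mem_of_intCast_eq Δ a hπ hker hcomb hh
    choose z hz using fun t => (hK t).exists_mulVec_eq (hy t)
    refine ⟨c, hc, fun s => z s.1 s.2, ?_⟩
    rw [mulVecLin_apply, hQv, hcy]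
    refine Finset.sum_congr rfl fun t _ => ?_
    rw [← mulVec_mulVec]
    exact congrArg _ (hz t)
  have hr : ∀ t, r t ≤ Fintype.card (ι × A' t) := fun t => by
    have h1 := Submodule.finrank_le
      (LinearMap.ker (regularMatrix (Δ.map (mapDomainRingHom ℤ (π t)))).mulVecLin)
    rwa [finrank_eq_card_basis (hK t).basis, Fintype.card_fin, finrank_fintype_fun_eq_card] at h1
  have hdetG : (G.det : ℝ) = ∏ t, ((o t : ℝ) ^ r t * gdet (LinearMap.ker
      (regularMatrix (Δ.map (mapDomainRingHom ℤ (π t)))).mulVecLin)) := by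
    have h1 : G.det = ∏ t, (o t ^ r t * gdet (LinearMap.ker
        (regularMatrix (Δ.map (mapDomainRingHom ℤ (π t)))).mulVecLin)) := by
      rw [hG, det_blockDiagonal'_eq_prod]
      refine Finset.prod_congr rfl fun t _ => ?_
      rw [det_smul, (hK t).gdet_eq, Fintype.card_fin]
    rw [h1]
    push_cast
    rfl
  have hcard : Fintype.card (Σ t, Fin (r t)) = ∑ t, r t := by simp
  refine (Int.cast_le.mpr hfin).trans (hbound.trans ?_)
  rw [hdetG, hcard, ← Finset.prod_pow_eq_pow_sum, ← Finset.prod_mul_distrib]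
  refine Finset.prod_le_prod (fun t _ => ?_) fun t _ => ?_
  · have := gdet_pos (LinearMap.ker
      (regularMatrix (Δ.map (mapDomainRingHom ℤ (π t)))).mulVecLin)
    have h2 := ho1 t
    positivity
  · have h1 := gdet_ker_le _ (hC t)
    have h2 : (1 : ℝ) ≤ o t := by exact_mod_cast ho1 t
    have h3 : ((o t : ℤ) : ℝ) = Nat.card (π t).ker := by simp [ho]
    rw [← h3, mul_pow, mul_pow, mul_assoc]
    have := gdet_pos (LinearMap.ker
      (regularMatrix (Δ.map (mapDomainRingHom ℤ (π t)))).mulVecLin)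
    gcongr
    · exact hr t
    · exact hr t

end KernelBound
end TorsionGrowth
end

noncomputable section

namespace TorsionGrowth

open Matrix Module AddMonoidAlgebra

/-! ### A uniform bound for the norm of the finite quotients of a matrix -/

section NormBound

/-- This is the Schur test: Cauchy-Schwarz with weights `|T i j|`, using the row sums first and the
column sums after exchanging the order of summation. -/
theorem dotProduct_mulVec_self_le {X Y : Type*} [Fintype X] [Fintype Y] (T : Matrix X Y ℝ) {s : ℝ}
    (hrow : ∀ i, ∑ j, |T i j| ≤ s) (hcol : ∀ j, ∑ i, |T i j| ≤ s) (x : Y → ℝ) :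
    (T *ᵥ x) ⬝ᵥ (T *ᵥ x) ≤ s ^ 2 * (x ⬝ᵥ x) := by
  have h1 : ∀ i, (T *ᵥ x) i * (T *ᵥ x) i ≤ s * ∑ j, |T i j| * x j ^ 2 := fun i => by
    have hcs := Finset.sum_sq_le_sum_mul_sum_of_sq_le_mul Finset.univ (r := fun j => T i j * x j)
      (f := fun j => |T i j|) (g := fun j => |T i j| * x j ^ 2) (fun j _ => abs_nonneg _)
      (fun j _ => by positivity) fun j _ => by
        rw [← mul_assoc, ← sq, sq_abs, mul_pow]
    rw [← sq]
    refine hcs.trans (mul_le_mul_of_nonneg_right (hrow i) ?_)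
    exact Finset.sum_nonneg fun j _ => by positivity
  rcases isEmpty_or_nonempty X with hX | ⟨⟨i₀⟩⟩
  · rw [dotProduct, Finset.univ_eq_empty, Finset.sum_empty]
    exact mul_nonneg (sq_nonneg s) (Finset.sum_nonneg fun i _ => mul_self_nonneg _)
  have hs : 0 ≤ s := (Finset.sum_nonneg fun j _ => abs_nonneg _).trans (hrow i₀)
  calc (T *ᵥ x) ⬝ᵥ (T *ᵥ x) ≤ ∑ i, s * ∑ j, |T i j| * x j ^ 2 := Finset.sum_le_sum fun i _ => h1 i
    _ = s * ∑ j, (∑ i, |T i j|) * x j ^ 2 := by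
      rw [← Finset.mul_sum, Finset.sum_comm]
      simp only [Finset.sum_mul]
    _ ≤ s * ∑ j, s * x j ^ 2 := by
      refine mul_le_mul_of_nonneg_left (Finset.sum_le_sum fun j _ => ?_) hs
      exact mul_le_mul_of_nonneg_right (hcol j) (sq_nonneg _)
    _ = s ^ 2 * (x ⬝ᵥ x) := by
      rw [← Finset.mul_sum, ← mul_assoc, ← sq, dotProduct]
      simp only [sq]

variable {G A : Type*} [AddCommGroup G] [AddCommGroup A] [Fintype A] {ι κ : Type*} [Fintype ι]
  [Fintype κ]

/-- The sum of the absolute values of the coefficients. -/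
def coeffNorm (f : AddMonoidAlgebra ℤ G) : ℝ :=
  f.coeff.sum fun _ a => |(a : ℝ)|

theorem coeffNorm_nonneg (f : AddMonoidAlgebra ℤ G) : 0 ≤ coeffNorm f :=
  Finset.sum_nonneg fun _ _ => abs_nonneg _

theorem sum_abs_coeff_mapDomain_le (φ : G →+ A) (f : AddMonoidAlgebra ℤ G) :
    ∑ b, |((mapDomainRingHom ℤ φ f).coeff b : ℝ)| ≤ coeffNorm f := by
  classical
  have h1 : ∀ b, ((mapDomainRingHom ℤ φ f).coeff b : ℝ)
      = ∑ h ∈ f.coeff.support, if φ h = b then (f.coeff h : ℝ) else 0 := fun b => by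
    rw [mapDomainRingHom_apply, coeff_mapDomain, Finsupp.mapDomain, Finsupp.sum,
      Finsupp.finsetSum_apply]
    push_cast
    refine Finset.sum_congr rfl fun h _ => ?_
    by_cases hb : φ h = b <;> simp [hb]
  calc ∑ b, |((mapDomainRingHom ℤ φ f).coeff b : ℝ)|
      ≤ ∑ b, ∑ h ∈ f.coeff.support, |if φ h = b then (f.coeff h : ℝ) else 0| :=
        Finset.sum_le_sum fun b _ => by
          rw [h1]
          exact Finset.abs_sum_le_sum_abs _ _
    _ = coeffNorm f := by
      rw [Finset.sum_comm, coeffNorm, Finsupp.sum]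
      refine Finset.sum_congr rfl fun h _ => ?_
      rw [Finset.sum_eq_single (φ h)] <;> simp +contextual [eq_comm]

/-- Row and column sums are controlled by the `ℓ¹`-norms of the entries, which do not grow under
`φ`. The bound is thus uniform over all finite quotients. -/
theorem dotProduct_regularMatrix_mulVec_self_le (M : Matrix ι κ (AddMonoidAlgebra ℤ G))
    (φ : G →+ A) (x : κ × A → ℝ) :
    ((BasedComplex.regularMatrix (M.map (mapDomainRingHom ℤ φ))).map (Int.cast : ℤ → ℝ) *ᵥ x) ⬝ᵥ
        ((BasedComplex.regularMatrix (M.map (mapDomainRingHom ℤ φ))).map (Int.cast : ℤ → ℝ) *ᵥ x)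
      ≤ (∑ i, ∑ j, coeffNorm (M i j)) ^ 2 * (x ⬝ᵥ x) := by
  refine dotProduct_mulVec_self_le _ ?_ ?_ x
  · rintro ⟨i, a⟩
    rw [Fintype.sum_prod_type]
    calc _ = ∑ j, ∑ b, |((mapDomainRingHom ℤ φ (M i j)).coeff b : ℝ)| := by
          refine Finset.sum_congr rfl fun j _ => ?_
          exact Fintype.sum_equiv (Equiv.subLeft a) _ _ fun b => rfl
      _ ≤ ∑ j, coeffNorm (M i j) :=
          Finset.sum_le_sum fun j _ => sum_abs_coeff_mapDomain_le φ (M i j)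
      _ ≤ _ := Finset.single_le_sum (f := fun i => ∑ j, coeffNorm (M i j))
          (fun i _ => Finset.sum_nonneg fun j _ => coeffNorm_nonneg _) (Finset.mem_univ i)
  · rintro ⟨j, b⟩
    rw [Fintype.sum_prod_type]
    calc _ = ∑ i, ∑ a, |((mapDomainRingHom ℤ φ (M i j)).coeff a : ℝ)| := by
          refine Finset.sum_congr rfl fun i _ => ?_
          exact Fintype.sum_equiv (Equiv.subRight b) _ _ fun a => rfl
      _ ≤ ∑ i, coeffNorm (M i j) :=
          Finset.sum_le_sum fun i _ => sum_abs_coeff_mapDomain_le φ (M i j)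
      _ ≤ _ := Finset.sum_le_sum fun i _ => Finset.single_le_sum (f := fun j => coeffNorm (M i j))
          (fun j _ => coeffNorm_nonneg _) (Finset.mem_univ j)

end NormBound

/-! ### The combinatorial Laplacian -/

section Laplacian

variable {G : Type*} [AddCommGroup G] {ι κ : Type*}

/-- The involution of `ℤ[G]` induced by the inversion of `G`. -/
def involution (G : Type*) [AddCommGroup G] : AddMonoidAlgebra ℤ G →+* AddMonoidAlgebra ℤ G :=
  mapDomainRingHom ℤ (negAddMonoidHom : G →+ G)

theorem coeff_involution (f : AddMonoidAlgebra ℤ G) (g : G) :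
    (involution G f).coeff g = f.coeff (-g) := by
  rw [involution, mapDomainRingHom_apply, coeff_mapDomain]
  conv_lhs => rw [← neg_neg g]
  exact Finsupp.mapDomain_apply neg_injective _ _

theorem involution_involution (f : AddMonoidAlgebra ℤ G) : involution G (involution G f) = f := by
  ext g
  rw [coeff_involution, coeff_involution, neg_neg]

theorem mapDomainRingHom_involution {G' : Type*} [AddCommGroup G'] (φ : G →+ G')
    (f : AddMonoidAlgebra ℤ G) :
    mapDomainRingHom ℤ φ (involution G f) = involution G' (mapDomainRingHom ℤ φ f) := by
  have h : φ.comp (negAddMonoidHom : G →+ G) = (negAddMonoidHom : G' →+ G').comp φ := by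
    ext g
    simp
  rw [involution, involution, ← RingHom.comp_apply, ← RingHom.comp_apply, ← mapDomainRingHom_comp,
    ← mapDomainRingHom_comp, h]

/-- The adjoint of a matrix over `ℤ[G]`. -/
def adjointMatrix (M : Matrix ι κ (AddMonoidAlgebra ℤ G)) : Matrix κ ι (AddMonoidAlgebra ℤ G) :=
  Mᵀ.map (involution G)

theorem adjointMatrix_map {G' : Type*} [AddCommGroup G'] (φ : G →+ G')
    (M : Matrix ι κ (AddMonoidAlgebra ℤ G)) :
    (adjointMatrix M).map (mapDomainRingHom ℤ φ) = adjointMatrix (M.map (mapDomainRingHom ℤ φ)) := by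
  ext1 i j
  exact mapDomainRingHom_involution φ _

theorem regularMatrix_adjointMatrix (M : Matrix ι κ (AddMonoidAlgebra ℤ G)) :
    BasedComplex.regularMatrix (adjointMatrix M) = (BasedComplex.regularMatrix M)ᵀ := by
  ext ⟨i, a⟩ ⟨j, b⟩
  simp [BasedComplex.regularMatrix, adjointMatrix, coeff_involution]

/-- Pairing with `v` gives `|Dᵀ v|² + |E v|²`, so both terms vanish separately. -/
theorem ker_mul_transpose_add {X Y Z : Type*} [Fintype X] [Fintype Y] [Fintype Z]
    (D : Matrix X Y ℤ) (E : Matrix Z X ℤ) :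
    LinearMap.ker (D * Dᵀ + Eᵀ * E).mulVecLin
      = LinearMap.ker E.mulVecLin ⊓ LinearMap.ker Dᵀ.mulVecLin := by
  ext v
  simp only [Submodule.mem_inf, LinearMap.mem_ker, mulVecLin_apply, add_mulVec, ← mulVec_mulVec]
  constructor
  · intro h
    have h1 := congrArg (v ⬝ᵥ ·) h
    simp only [dotProduct_add, dotProduct_zero] at h1
    rw [dotProduct_mulVec, dotProduct_mulVec v Eᵀ, ← mulVec_transpose, vecMul_transpose] at h1
    have h2 : 0 ≤ (Dᵀ *ᵥ v) ⬝ᵥ (Dᵀ *ᵥ v) := Finset.sum_nonneg fun i _ => mul_self_nonneg _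
    have h3 : 0 ≤ (E *ᵥ v) ⬝ᵥ (E *ᵥ v) := Finset.sum_nonneg fun i _ => mul_self_nonneg _
    exact ⟨dotProduct_self_eq_zero.mp (by omega), dotProduct_self_eq_zero.mp (by omega)⟩
  · rintro ⟨h1, h2⟩
    rw [h1, h2, mulVec_zero, mulVec_zero, add_zero]

namespace BasedComplex

/-- The combinatorial Laplacian `∂_{k+1} ∂_{k+1}^* + ∂_k^* ∂_k`. -/
def laplacian (C : BasedComplex (AddMonoidAlgebra ℤ G)) :
    (k : ℕ) → Matrix (C.ι k) (C.ι k) (AddMonoidAlgebra ℤ G)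
  | 0 => C.d 0 * adjointMatrix (C.d 0)
  | k + 1 => C.d (k + 1) * adjointMatrix (C.d (k + 1)) + adjointMatrix (C.d k) * C.d k

theorem laplacian_baseChange {G' : Type*} [AddCommGroup G'] (φ : G →+ G')
    (C : BasedComplex (AddMonoidAlgebra ℤ G)) (k : ℕ) :
    (C.baseChange (mapDomainRingHom ℤ φ)).laplacian k
      = (C.laplacian k).map (mapDomainRingHom ℤ φ) := by
  cases k with
  | zero =>
    simp only [laplacian, Matrix.map_mul, adjointMatrix_map]
    rfl
  | succ k =>
    simp only [laplacian, Matrix.map_mul, adjointMatrix_map, Matrix.map_add _ (map_add _)]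
    rfl

theorem harmonic_restrictScalars {A : Type} [AddCommGroup A] [Fintype A] [DecidableEq A]
    (E : BasedComplex (AddMonoidAlgebra ℤ A)) (k : ℕ) :
    E.restrictScalars.harmonic k = LinearMap.ker (regularMatrix (E.laplacian k)).mulVecLin := by
  cases k with
  | zero =>
    -- In degree zero a matrix without rows stands for `∂_0`.
    have h := ker_mul_transpose_add (regularMatrix (E.d 0)) (0 : Matrix Empty (E.ι 0 × A) ℤ)
    rw [mulVecLin_zero, LinearMap.ker_zero, Matrix.mul_zero, add_zero] at h
    rw [laplacian, ← regularMatrix_mul, regularMatrix_adjointMatrix]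
    exact h.symm
  | succ k =>
    have h := ker_mul_transpose_add (regularMatrix (E.d (k + 1))) (regularMatrix (E.d k))
    rw [laplacian, regularMatrix_add, ← regularMatrix_mul, ← regularMatrix_mul,
      regularMatrix_adjointMatrix, regularMatrix_adjointMatrix]
    exact h.symm

end BasedComplex

end Laplacian

end TorsionGrowth
end

noncomputable section

namespace TorsionGrowth

open Matrix Module AddMonoidAlgebra BasedComplex

/-! ### The Laplacian of an `L²`-acyclic complex -/

section Positivity

variable {G : Type*} [AddCommGroup G] {ι κ ρ : Type*} [Fintype ι] [Fintype κ] [Fintype ρ]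

theorem coeff_zero_involution_mul_self (f : AddMonoidAlgebra ℤ G) :
    (involution G f * f).coeff 0 = ∑ g ∈ f.coeff.support, f.coeff g ^ 2 := by
  rw [mul_comm, coeff_mul_apply_left, Finsupp.sum]
  refine Finset.sum_congr rfl fun g _ => ?_
  rw [add_zero, coeff_involution, neg_neg, sq]

/-- The Hermitian form of `ℤ[G]^ι`. -/
def hermitianForm (u v : ι → AddMonoidAlgebra ℤ G) : AddMonoidAlgebra ℤ G :=
  (involution G ∘ u) ⬝ᵥ v

theorem hermitianForm_mulVec (M : Matrix ι κ (AddMonoidAlgebra ℤ G))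
    (u : ι → AddMonoidAlgebra ℤ G) (v : κ → AddMonoidAlgebra ℤ G) :
    hermitianForm u (M *ᵥ v) = hermitianForm (adjointMatrix M *ᵥ u) v := by
  have h : (involution G ∘ u) ᵥ* M = involution G ∘ (adjointMatrix M *ᵥ u) := by
    ext1 j
    rw [Function.comp_apply, RingHom.map_mulVec, ← mulVec_transpose]
    congr 2
    ext1 a b
    exact (involution_involution _).symm
  rw [hermitianForm, dotProduct_mulVec, h, hermitianForm]

theorem adjointMatrix_adjointMatrix (M : Matrix ι κ (AddMonoidAlgebra ℤ G)) :
    adjointMatrix (adjointMatrix M) = M := by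
  ext1 a b
  exact involution_involution _

theorem coeff_zero_hermitianForm_self (v : ι → AddMonoidAlgebra ℤ G) :
    (hermitianForm v v).coeff 0 = ∑ i, ∑ g ∈ (v i).coeff.support, (v i).coeff g ^ 2 := by
  rw [hermitianForm, dotProduct, coeff_sum, Finsupp.finsetSum_apply]
  exact Finset.sum_congr rfl fun i _ => coeff_zero_involution_mul_self (v i)

theorem coeff_zero_hermitianForm_self_nonneg (v : ι → AddMonoidAlgebra ℤ G) :
    0 ≤ (hermitianForm v v).coeff 0 := by
  rw [coeff_zero_hermitianForm_self]
  exact Finset.sum_nonneg fun i _ => Finset.sum_nonneg fun g _ => sq_nonneg _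

theorem eq_zero_of_coeff_zero_hermitianForm_self {v : ι → AddMonoidAlgebra ℤ G}
    (h : (hermitianForm v v).coeff 0 = 0) : v = 0 := by
  rw [coeff_zero_hermitianForm_self, Finset.sum_eq_zero_iff_of_nonneg
    fun i _ => Finset.sum_nonneg fun g _ => sq_nonneg _] at h
  ext i g
  have h1 := h i (Finset.mem_univ i)
  rw [Finset.sum_eq_zero_iff_of_nonneg fun g _ => sq_nonneg _] at h1
  by_contra hg
  exact hg (pow_eq_zero_iff two_ne_zero |>.mp (h1 g (Finsupp.mem_support_iff.mpr hg)))

/-- The coefficient at zero of `hermitianForm v v` is the sum of the squares of all coefficients of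
`v`, a positive definite trace. Positivity of the Laplacian is thereby available inside `ℤ[G]`. -/
theorem eq_zero_of_mul_adjointMatrix_add_mulVec_eq_zero (D : Matrix ι κ (AddMonoidAlgebra ℤ G))
    (E : Matrix ρ ι (AddMonoidAlgebra ℤ G)) {v : ι → AddMonoidAlgebra ℤ G}
    (h : (D * adjointMatrix D + adjointMatrix E * E) *ᵥ v = 0) :
    adjointMatrix D *ᵥ v = 0 ∧ E *ᵥ v = 0 := by
  have h1 : hermitianForm v ((D * adjointMatrix D + adjointMatrix E * E) *ᵥ v) = 0 := by
    rw [h, hermitianForm, dotProduct_zero]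
  rw [add_mulVec, ← mulVec_mulVec, ← mulVec_mulVec, hermitianForm, dotProduct_add] at h1
  change hermitianForm v _ + hermitianForm v _ = 0 at h1
  rw [hermitianForm_mulVec D, hermitianForm_mulVec (adjointMatrix E), adjointMatrix_adjointMatrix] at h1
  have h2 : (hermitianForm (adjointMatrix D *ᵥ v) (adjointMatrix D *ᵥ v)).coeff 0
      + (hermitianForm (E *ᵥ v) (E *ᵥ v)).coeff 0 = 0 := by
    rw [← Finsupp.add_apply, ← coeff_add, h1]
    rfl
  have h3 := coeff_zero_hermitianForm_self_nonneg (adjointMatrix D *ᵥ v)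
  have h4 := coeff_zero_hermitianForm_self_nonneg (E *ᵥ v)
  exact ⟨eq_zero_of_coeff_zero_hermitianForm_self (by omega),
    eq_zero_of_coeff_zero_hermitianForm_self (by omega)⟩

end Positivity

/-! ### Passage from `ℤ[G]` to `ℓ²(G)` -/

section SquareSummable

variable {G : Type*} [AddCommGroup G]

theorem memℓp_coeff (f : AddMonoidAlgebra ℤ G) : Memℓp (fun g => (f.coeff g : ℂ)) 2 := by
  rw [memℓp_gen_iff (by norm_num)]
  refine summable_of_ne_finset_zero (s := f.coeff.support) fun g hg => ?_
  rw [Finsupp.notMem_support_iff.mp hg]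
  simp

/-- An element of `ℤ[G]` as a square summable function. -/
def toL2 (f : AddMonoidAlgebra ℤ G) : L2 G := ⟨fun g => (f.coeff g : ℂ), memℓp_coeff f⟩

theorem toL2_apply (f : AddMonoidAlgebra ℤ G) (g : G) : toL2 f g = (f.coeff g : ℂ) := rfl

theorem toL2_injective : Function.Injective (toL2 (G := G)) := fun f f' h => by
  ext g
  have := congrArg (fun x : L2 G => x g) h
  simpa [toL2_apply] using this

theorem toL2_zero : toL2 (0 : AddMonoidAlgebra ℤ G) = 0 := by
  ext g
  simp [toL2_apply]

theorem toL2_sum {τ : Type*} (s : Finset τ) (f : τ → AddMonoidAlgebra ℤ G) :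
    toL2 (∑ t ∈ s, f t) = ∑ t ∈ s, toL2 (f t) := by
  ext g
  rw [lp.coeFn_sum, Finset.sum_apply]
  simp [toL2_apply, coeff_sum, Finsupp.finsetSum_apply]

theorem convolution_apply (f : AddMonoidAlgebra ℤ G) (x : L2 G) :
    convolution f x = f.coeff.sum fun h a => (a : ℂ) • l2Translate h x := by
  simp [convolution, Finsupp.sum]

theorem convolution_toL2 (f f' : AddMonoidAlgebra ℤ G) :
    convolution f (toL2 f') = toL2 (f * f') := by
  ext g
  rw [convolution_apply, toL2_apply, coeff_mul_apply_left, Finsupp.sum, Finsupp.sum, lp.coeFn_sum,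
    Finset.sum_apply]
  push_cast
  refine Finset.sum_congr rfl fun h _ => ?_
  rw [neg_add_eq_sub]
  rfl

theorem inner_l2Translate (h : G) (x y : L2 G) :
    inner ℂ x (l2Translate h y) = inner ℂ (l2Translate (-h) x) y := by
  have h1 : l2Translate h (l2Translate (-h) x) = x := by
    ext g
    change x (g - h - -h) = x g
    rw [sub_neg_eq_add, sub_add_cancel]
  conv_lhs => rw [← h1]
  exact (l2Translate h).inner_map_map _ _

theorem inner_convolution (f : AddMonoidAlgebra ℤ G) (x y : L2 G) :
    inner ℂ x (convolution f y) = inner ℂ (convolution (involution G f) x) y := by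
  rw [convolution_apply, convolution_apply, involution, mapDomainRingHom_apply, coeff_mapDomain,
    Finsupp.sum_mapDomain_index (by simp) (by simp [add_smul]), Finsupp.sum, Finsupp.sum, inner_sum,
    sum_inner]
  refine Finset.sum_congr rfl fun h _ => ?_
  rw [inner_smul_right, inner_smul_left, inner_l2Translate]
  simp

variable (C : BasedComplex (AddMonoidAlgebra ℤ G))

theorem l2Boundary_toL2 (k : ℕ) (v : C.ι (k + 1) → AddMonoidAlgebra ℤ G) :
    C.l2Boundary k (toL2 ∘ v) = toL2 ∘ (C.d k *ᵥ v) := by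
  ext1 i
  simp [l2Boundary, convolution_toL2, mulVec, dotProduct, toL2_sum]

theorem inner_l2Boundary (k : ℕ) (v : C.ι k → AddMonoidAlgebra ℤ G) (y : C.L2Chains (k + 1)) :
    ∑ i, inner ℂ (toL2 (v i)) (C.l2Boundary k y i)
      = ∑ j, inner ℂ (toL2 ((adjointMatrix (C.d k) *ᵥ v) j)) (y j) := by
  have h1 : ∀ i, C.l2Boundary k y i = ∑ j, convolution (C.d k i j) (y j) := fun i => by
    simp [l2Boundary]
  simp only [h1, inner_sum, inner_convolution, convolution_toL2]
  rw [Finset.sum_comm]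
  refine Finset.sum_congr rfl fun j _ => ?_
  rw [← sum_inner, ← toL2_sum]
  rfl

/-- A chain killed by the adjoint boundary is orthogonal to the boundaries, hence to their closure;
if it lies in that closure it is orthogonal to itself. -/
theorem eq_zero_of_mem_l2Boundaries {k : ℕ} {v : C.ι k → AddMonoidAlgebra ℤ G}
    (hv : (toL2 ∘ v : C.L2Chains k) ∈ C.l2Boundaries k) (hD : adjointMatrix (C.d k) *ᵥ v = 0) :
    v = 0 := by
  let Φ : C.L2Chains k →L[ℂ] ℂ :=
    ∑ i, (innerSL ℂ (toL2 (v i))).comp (ContinuousLinearMap.proj i)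
  have hΦ : ∀ x, Φ x = ∑ i, inner ℂ (toL2 (v i)) (x i) := fun x => by simp [Φ]
  have h1 : C.l2Boundaries k ≤ LinearMap.ker Φ.toLinearMap := by
    refine Submodule.topologicalClosure_minimal _ ?_ Φ.isClosed_ker
    rintro _ ⟨y, rfl⟩
    change Φ (C.l2Boundary k y) = 0
    rw [hΦ, inner_l2Boundary, hD]
    simp [toL2_zero]
  have h2 : Φ (toL2 ∘ v) = 0 := h1 hv
  rw [hΦ] at h2
  have h3 : ∑ i, ‖toL2 (v i)‖ ^ 2 = 0 := by
    have h4 := congrArg Complex.re h2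
    simpa [inner_self_eq_norm_sq_to_K, ← Complex.ofReal_pow] using h4
  rw [Finset.sum_eq_zero_iff_of_nonneg fun i _ => sq_nonneg _] at h3
  ext1 i
  refine toL2_injective ?_
  rw [Pi.zero_apply, toL2_zero]
  simpa using h3 i (Finset.mem_univ i)

theorem l2Cycles_le_l2Boundaries (hC : C.IsL2Acyclic) (k : ℕ) : C.l2Cycles k ≤ C.l2Boundaries k := by
  intro x hx
  have := hC k
  exact (Submodule.Quotient.mk_eq_zero ((C.l2Boundaries k).submoduleOf (C.l2Cycles k))).mp
    (Subsingleton.elim (Submodule.Quotient.mk ⟨x, hx⟩ : C.L2Homology k) 0)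

/-- Over a domain, a vanishing determinant gives a nonzero vector with entries in `ℤ[G]` in the
kernel. It is finitely supported and harmonic, hence an `ℓ²`-cycle, which acyclicity places in the
closure of the boundaries. -/
theorem det_laplacian_ne_zero [IsDomain (AddMonoidAlgebra ℤ G)] (hC : C.IsL2Acyclic) (k : ℕ) :
    (C.laplacian k).det ≠ 0 := by
  intro h0
  obtain ⟨v, hv0, hv⟩ := exists_mulVec_eq_zero_iff.mpr h0
  refine hv0 ?_
  cases k with
  | zero =>
    have h1 := eq_zero_of_mul_adjointMatrix_add_mulVec_eq_zero (C.d 0)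
      (0 : Matrix Empty (C.ι 0) (AddMonoidAlgebra ℤ G)) (v := v)
      (by rwa [Matrix.mul_zero, add_zero])
    exact eq_zero_of_mem_l2Boundaries C (l2Cycles_le_l2Boundaries C hC 0 trivial) h1.1
  | succ k =>
    have h1 := eq_zero_of_mul_adjointMatrix_add_mulVec_eq_zero (C.d (k + 1)) (C.d k) hv
    refine eq_zero_of_mem_l2Boundaries C (l2Cycles_le_l2Boundaries C hC (k + 1) ?_) h1.1
    change C.l2Boundary k (toL2 ∘ v) = 0
    rw [l2Boundary_toL2, h1.2]
    ext1 i
    exact toL2_zero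

end SquareSummable

end TorsionGrowth
end

noncomputable section

namespace TorsionGrowth

open Matrix Module AddMonoidAlgebra BasedComplex

/-! ### Word length -/

section WordLengthBounds

variable {G : Type*} [AddCommGroup G] {S : Set G}

theorem exists_word (hS : AddSubgroup.closure S = ⊤) (x : G) :
    ∃ l : List G, l.length = wordLength S x ∧ (∀ y ∈ l, y ∈ S ∨ -y ∈ S) ∧ l.sum = x := by
  refine Nat.sInf_mem (s := {k | ∃ l : List G, l.length = k ∧ (∀ y ∈ l, y ∈ S ∨ -y ∈ S) ∧ l.sum = x})
    ?_
  have hx : x ∈ (AddSubgroup.closure S).toAddSubmonoid := hS ▸ AddSubgroup.mem_top x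
  rw [AddSubgroup.closure_toAddSubmonoid] at hx
  obtain ⟨l, hl, hsum⟩ := AddSubmonoid.exists_list_of_mem_closure hx
  exact ⟨l.length, l, rfl, hl, hsum⟩

theorem wordLength_nsmul_le (hS : AddSubgroup.closure S = ⊤) (n : ℕ) (x : G) :
    wordLength S (n • x) ≤ n * wordLength S x := by
  obtain ⟨l, hl, hmem, hsum⟩ := exists_word hS x
  refine Nat.sInf_le ⟨(List.replicate n l).flatten, ?_, fun y hy => ?_, ?_⟩
  · simp [hl]
  · obtain ⟨l', hl', hy⟩ := List.mem_flatten.mp hy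
    rw [List.eq_of_mem_replicate hl'] at hy
    exact hmem y hy
  · rw [List.sum_flatten, List.map_replicate, List.sum_replicate, hsum]

/-- If `o` is the order of `m` modulo `Γ`, then `o • m` is a nonzero element of `Γ` of word length
at most `o` times that of `m`. So the order of a fixed direction grows with `⟨Γ⟩`. -/
theorem le_addOrderOf_mul_wordLength (hS : AddSubgroup.closure S = ⊤) [IsAddTorsionFree G]
    {Γ : AddSubgroup G} [Γ.FiniteIndex] {N : ℕ} (hN : (N : ℕ∞) ≤ minLength S Γ) {m : G}
    (hm : m ≠ 0) : N ≤ addOrderOf (m : G ⧸ Γ) * wordLength S m := by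
  have : Finite (G ⧸ Γ) := inferInstance
  have ho : 0 < addOrderOf (m : G ⧸ Γ) := addOrderOf_pos _
  have h1 : addOrderOf (m : G ⧸ Γ) • m ∈ Γ := by
    rw [← QuotientAddGroup.eq_zero_iff, QuotientAddGroup.mk_nsmul]
    exact addOrderOf_nsmul_eq_zero _
  have h2 : addOrderOf (m : G ⧸ Γ) • m ≠ 0 := by
    rw [Ne, nsmul_eq_zero_iff_right ho.ne']
    exact hm
  have h3 : (N : ℕ∞) ≤ wordLength S (addOrderOf (m : G ⧸ Γ) • m) :=
    hN.trans (iInf₂_le _ ⟨h1, h2⟩)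
  exact (Nat.cast_le.mp h3).trans (wordLength_nsmul_le hS _ m)

end WordLengthBounds

/-! ### The growth of the harmonic lattices -/

section Growth

open Filter Topology

theorem exists_mul_log_le (a : ℝ) {K δ : ℝ} (hK : 0 < K) (hδ : 0 < δ) :
    ∃ X : ℕ, 0 < X ∧ ∀ o : ℕ, X ≤ o → a * Real.log (K * o) ≤ δ * o := by
  have h1 : Tendsto (fun x : ℝ => Real.log x / x) atTop (𝓝 0) := by
    simpa using Real.isLittleO_log_id_atTop.tendsto_div_nhds_zero
  have h2 : Tendsto (fun o : ℕ => K * (o : ℝ)) atTop atTop :=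
    tendsto_natCast_atTop_atTop.const_mul_atTop hK
  have h3 : Tendsto (fun o : ℕ => a * K * (Real.log (K * o) / (K * o))) atTop (𝓝 0) := by
    simpa using (h1.comp h2).const_mul (a * K)
  obtain ⟨X, hX⟩ := eventually_atTop.mp (h3.eventually_lt_const hδ)
  refine ⟨X + 1, X.succ_pos, fun o ho => ?_⟩
  have ho0 : (0 : ℝ) < o := by exact_mod_cast (show 0 < o by omega)
  have h4 := hX o (by omega)
  have h5 : a * K * (Real.log (K * o) / (K * o)) = a * Real.log (K * o) / o := by
    field_simp
  rw [h5, div_lt_iff₀ ho0] at h4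
  exact h4.le

variable {G : Type} [AddCommGroup G] [IsAddTorsionFree G]

/-- `K` depends only on `Δ`. The integer `c` of the ideal identity may depend on `A` and `φ`, but it
does not enter the bound. -/
theorem log_gdet_ker_regularMatrix_le {ι : Type*} [Fintype ι] [DecidableEq ι]
    (Δ : Matrix ι ι (AddMonoidAlgebra ℤ G)) (hΔ : Δ.det ≠ 0) :
    ∃ K : ℝ, 0 < K ∧ ∀ (A : Type) [AddCommGroup A] [Fintype A] (φ : G →+ A),
      Real.log (gdet (LinearMap.ker
          (regularMatrix (Δ.map (mapDomainRingHom ℤ φ))).mulVecLin))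
        ≤ ∑ m : specialDirections Δ.det, (Fintype.card ι : ℝ) *
          (Nat.card A / addOrderOf (φ m)) * Real.log (K * addOrderOf (φ m)) := by
  classical
  set C : ℝ := (∑ i, ∑ j, coeffNorm (Δ i j)) ^ 2
  have hC : 0 ≤ C := sq_nonneg _
  refine ⟨(Fintype.card (specialDirections Δ.det) + 1) * (C + 1), by positivity, ?_⟩
  intro A _ _ φ
  obtain ⟨c, g, q, hc, hcomb⟩ := exists_intCast_eq_mul_add_sum hΔ φ
  let _ (m : specialDirections Δ.det) : Fintype (A ⧸ AddSubgroup.zmultiples (φ m)) := Fintype.ofFinite _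
  have hdet : mapDomainRingHom ℤ φ Δ.det = (Δ.map (mapDomainRingHom ℤ φ)).det :=
    RingHom.map_det _ _
  rw [hdet] at hcomb
  have key := gdet_ker_regularMatrix_le (Δ.map (mapDomainRingHom ℤ φ))
    (fun m : specialDirections Δ.det => φ m)
    (π := fun m => QuotientAddGroup.mk' (AddSubgroup.zmultiples (φ m)))
    (fun m => QuotientAddGroup.mk'_surjective _) (fun m => QuotientAddGroup.ker_mk' _) hc hcomb
    (C := C) hC fun m x => by
      have h := dotProduct_regularMatrix_mulVec_self_le Δ
        ((QuotientAddGroup.mk' (AddSubgroup.zmultiples (φ m))).comp φ) x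
      rwa [mapDomainRingHom_comp] at h
  have hpos := gdet_pos (LinearMap.ker
    (regularMatrix (Δ.map (mapDomainRingHom ℤ φ))).mulVecLin)
  have ho : ∀ m : specialDirections Δ.det, 0 < addOrderOf (φ m) := fun m => addOrderOf_pos _
  refine (Real.log_le_log (by exact_mod_cast hpos) key).trans (le_of_eq ?_)
  have hcard : ∀ m : specialDirections Δ.det,
      Nat.card (QuotientAddGroup.mk' (AddSubgroup.zmultiples (φ m))).ker = addOrderOf (φ m) := by
    intro m
    rw [QuotientAddGroup.ker_mk', Nat.card_zmultiples]
  rw [Real.log_prod fun m _ => by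
    rw [hcard]
    have : (0 : ℝ) < addOrderOf (φ m) := by exact_mod_cast ho m
    positivity]
  refine Finset.sum_congr rfl fun m _ => ?_
  have ho' : (0 : ℝ) < addOrderOf (φ m) := by exact_mod_cast ho m
  have hq : (Nat.card A : ℝ) / addOrderOf (φ m)
      = Fintype.card (A ⧸ AddSubgroup.zmultiples (φ m)) := by
    rw [div_eq_iff ho'.ne', ← Nat.card_eq_fintype_card, ← Nat.card_zmultiples]
    exact_mod_cast AddSubgroup.card_eq_card_quotient_mul_card_addSubgroup _
  rw [Real.log_pow, hcard, hq, Fintype.card_prod]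
  push_cast
  congr 2
  ring

theorem exists_log_gdet_harmonic_le {S : Set G} (hS : AddSubgroup.closure S = ⊤)
    [IsDomain (AddMonoidAlgebra ℤ G)] (C : BasedComplex (AddMonoidAlgebra ℤ G))
    (hC : C.IsL2Acyclic) (k : ℕ) {δ : ℝ} (hδ : 0 < δ) :
    ∃ N : ℕ, ∀ (Γ : AddSubgroup G) [Γ.FiniteIndex], (N : ℕ∞) ≤ minLength S Γ →
      Real.log (gdet ((C.quotient Γ).harmonic k)) ≤ δ * Γ.index := by
  classical
  obtain ⟨K, hK, hbound⟩ := log_gdet_ker_regularMatrix_le (C.laplacian k)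
    (det_laplacian_ne_zero C hC k)
  set f := (C.laplacian k).det
  -- The extra one keeps `δ / s` meaningful when there are no special directions.
  set s : ℝ := Fintype.card (specialDirections f) + 1
  have hs : 0 < s := by positivity
  obtain ⟨X, hX0, hX⟩ := exists_mul_log_le (Fintype.card (C.ι k)) hK (div_pos hδ hs)
  -- `W` bounds the word length of every special direction and is positive, so `⟨Γ⟩ ≥ X * W` forces
  -- each of their orders to be at least `X`.
  set W : ℕ := ∑ m ∈ specialDirections f, wordLength S m + 1
  refine ⟨X * W, fun Γ _ hΓ => ?_⟩
  let _ : Fintype (G ⧸ Γ) := Fintype.ofFinite _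
  have h1 : (C.quotient Γ).harmonic k = LinearMap.ker (regularMatrix
      ((C.laplacian k).map (mapDomainRingHom ℤ (QuotientAddGroup.mk' Γ)))).mulVecLin := by
    rw [← laplacian_baseChange]
    exact harmonic_restrictScalars _ k
  have h2 := hbound (G ⧸ Γ) (QuotientAddGroup.mk' Γ)
  have h3 : Real.log (gdet ((C.quotient Γ).harmonic k)) = Real.log (gdet (LinearMap.ker
      (regularMatrix
      ((C.laplacian k).map (mapDomainRingHom ℤ (QuotientAddGroup.mk' Γ)))).mulVecLin)) := by
    rw [h1]
    rfl
  rw [h3]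
  refine h2.trans ?_
  have hidx : (Γ.index : ℝ) = Nat.card (G ⧸ Γ) := rfl
  rw [hidx]
  have hA : (0 : ℝ) ≤ Nat.card (G ⧸ Γ) := by positivity
  calc _ ≤ ∑ m : specialDirections f, δ / s * Nat.card (G ⧸ Γ) := by
        refine Finset.sum_le_sum fun m _ => ?_
        set o := addOrderOf (QuotientAddGroup.mk' Γ (m : G)) with ho
        have ho0 : 0 < o := addOrderOf_pos _
        have ho' : (0 : ℝ) < o := by exact_mod_cast ho0
        have hm := ne_zero_of_mem_specialDirections m.2
        have hXo : X ≤ o := by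
          have h4 := le_addOrderOf_mul_wordLength hS hΓ hm
          have h5 : wordLength S (m : G) ≤ W :=
            (Finset.single_le_sum (f := fun m => wordLength S m) (fun _ _ => Nat.zero_le _) m.2).trans
              (Nat.le_succ _)
          have h6 : X * W ≤ o * W := h4.trans (Nat.mul_le_mul_left _ h5)
          exact Nat.le_of_mul_le_mul_right h6 (Nat.succ_pos _)
        have h7 := hX o hXo
        calc _ = Nat.card (G ⧸ Γ) / o * (Fintype.card (C.ι k) * Real.log (K * o)) := by ring
          _ ≤ Nat.card (G ⧸ Γ) / o * (δ / s * o) :=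
              mul_le_mul_of_nonneg_left h7 (by positivity)
          _ = δ / s * Nat.card (G ⧸ Γ) := by field_simp
    _ = (s - 1) * (δ / s * Nat.card (G ⧸ Γ)) := by simp [s]
    _ ≤ s * (δ / s * Nat.card (G ⧸ Γ)) :=
        mul_le_mul_of_nonneg_right (by linarith) (by positivity)
    _ = δ * Nat.card (G ⧸ Γ) := by field_simp

end Growth

end TorsionGrowth
end

/-! ### The main theorem -/

theorem theorem1 (n : ℕ) (S : Finset (Fin n → ℤ))
    (hS : AddSubgroup.closure (S : Set (Fin n → ℤ)) = ⊤)
    (C : TorsionGrowth.BasedComplex (AddMonoidAlgebra ℤ (Fin n → ℤ))) (hC : C.IsL2Acyclic) :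
    ∀ ε : ℝ, 0 < ε → ∃ N : ℕ, ∀ (Γ : AddSubgroup (Fin n → ℤ)) [Γ.FiniteIndex],
      (N : ℕ∞) ≤ TorsionGrowth.minLength (S : Set (Fin n → ℤ)) Γ →
        |(Real.log (C.quotient Γ).homologyTorsion - Real.log (C.quotient Γ).raySingerTorsion) /
          (Γ.index : ℝ)| < ε := by
  intro ε hε
  -- The error is shared equally among the `C.length + 1` degrees; the factor one half in the
  -- torsion comparison makes the final inequality strict.
  have hδ : 0 < ε / (C.length + 1) := by positivity
  choose N hN using fun k => TorsionGrowth.exists_log_gdet_harmonic_le hS C hC k hδ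
  refine ⟨∑ k ∈ Finset.range (C.length + 1), N k, fun Γ _ hΓ => ?_⟩
  have hidx : (0 : ℝ) < Γ.index := by
    exact_mod_cast Nat.pos_of_ne_zero AddSubgroup.FiniteIndex.index_ne_zero
  rw [abs_div, abs_of_pos hidx, div_lt_iff₀ hidx]
  refine (C.quotient Γ).abs_log_homologyTorsion_sub_log_raySingerTorsion_le.trans_lt ?_
  have h1 : ∑ k ∈ Finset.range (C.length + 1),
      Real.log (TorsionGrowth.gdet ((C.quotient Γ).harmonic k))
        ≤ ∑ k ∈ Finset.range (C.length + 1), ε / (C.length + 1) * Γ.index := by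
    refine Finset.sum_le_sum fun k hk => hN k Γ (le_trans ?_ hΓ)
    exact_mod_cast Finset.single_le_sum (fun _ _ => Nat.zero_le _) hk
  have h2 : ∑ k ∈ Finset.range (C.length + 1), ε / (C.length + 1) * (Γ.index : ℝ)
      = ε * Γ.index := by
    rw [Finset.sum_const, Finset.card_range, nsmul_eq_mul]
    push_cast
    field_simp
  have h3 : 0 < ε * Γ.index := by positivity
  change (∑ k ∈ Finset.range (C.length + 1),
      Real.log (TorsionGrowth.gdet ((C.quotient Γ).harmonic k))) / 2 < _
  linarith
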